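/- **Setting.** An inverse monoid is a monoid $S$ in which every $s$ has a unique weak inverse $s^*$, i.e. $ss^*s=s$ and $s^*ss^*=s^*$. Let $\mathbf{StatMeas}$ be the category whose objects are triples $(X,S,\mathcal A)$, where $(X,\mathcal A)$ is a measurable space and $S$ is an inverse monoid acting on the left on $X$ by measurable maps $X\to X$, and whose morphisms $(X,S,\mathcal A)\to(Y,T,\mathcal B)$ are the measurable maps $f:X\to Y$ for which there exists a monoid homomorphism $f^*:T\to S$ with $f^{-1}(t^{-1}(B))=(f^*(t))^{-1}(f^{-1}(B))$ for all $t\in T$, $B\in\mathcal B$. The disjunctive algebra $\overline{\mathcal A}$ consists of the formal countable coproducts $\coprod_i P_i$ with $P_i\in\mathcal A$, where two such expressions denote the same coproduct if they have a common refinement by countable measurable partitions of their summands; put $s^{-1}(\coprod_i P_i)=\coprod_i s^{-1}P_i$. Elements $P,Q$ of $\overline{\mathcal A}$ are equidecomposable, $P\eqsim_S Q$, if $P=\coprod_j P_j$ and $Q=\coprod_j Q_j$ for sequences $(P_j),(Q_j)$ in $\overline{\mathcal A}$ and there are sequences $(s_j),(t_j)$ in $S$ with $s_j^{-1}P_j=t_j^{-1}Q_j$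 for all $j$. This is an equivalence relation. Put $\mathcal T(X,S,\mathcal A)=\overline{\mathcal A}/\eqsim_S$, with $[P]+[Q]=[P\coprod Q]$, $0=[\varnothing]$ and $\sum_{j}[P_j]=[\coprod_j P_j]$ for sequences (all well defined); put $\mathcal T f[\coprod_j B_j]=[\coprod_j f^{-1}B_j]$ for a morphism $f$, and $m_{(X,S,\mathcal A)}(A)=[A]$ for $A\in\mathcal A$ (Tarski measure). **Theorem.** $\mathcal T$ is a contravariant functor from $\mathbf{StatMeas}$ to the category $\mathbf{Mon}$ of monoids and monoid homomorphisms, and: 1. For every $(X,S,\mathcal A)$ and all $\alpha,\beta\in\mathcal T(X,S,\mathcal A)$: (a) $\alpha+\beta=\beta+\alpha$; (b) the canonical preorder ($\alpha\preceq\beta\iff\exists\gamma,\ \alpha+\gamma=\beta$) is a partial order; (c) if $n\alpha=n\beta$ for some integer $n\ge1$, then $\alpha=\beta$. 2. For every $(X,S,\mathcal A)$ the map $m=m_{(X,S,\mathcal A)}:\mathcal A\to\mathcal T(X,S,\mathcal A)$ satisfies: (a) $m(\varnothing)=0$; (b) $m(\bigcup_{i=1}^\infty A_i)=\sum_{i=1}^\infty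 m(A_i)$ for every sequence of pairwise disjoint sets $A_i\in\mathcal A$; (c) $m(A)=m(s^{-1}A)$ for all $s\in S$, $A\in\mathcal A$. 3. For every morphism $f:(X,S,\mathcal A)\to(Y,T,\mathcal B)$ the monoid homomorphism $\mathcal T f:\mathcal T(Y,T,\mathcal B)\to\mathcal T(X,S,\mathcal A)$ satisfies: (a) $\mathcal T f(\sum_{i=1}^\infty a_i)=\sum_{i=1}^\infty\mathcal T f(a_i)$ for every sequence $(a_i)$ in $\mathcal T(Y,T,\mathcal B)$; (b) $m_{(X,S,\mathcal A)}(f^{-1}(B))=\mathcal T f(m_{(Y,T,\mathcal B)}(B))$ for all $B\in\mathcal B$. -/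

import Mathlib

open CategoryTheory Opposite

universe u v

/-- An inverse monoid: every `s` has a unique weak inverse, i.e. a unique `t` with
`s t s = s` and `t s t = t`. -/
class IsInverseMonoid (S : Type*) [Monoid S] : Prop where
  existsUnique_weakInv : ∀ s : S, ∃! t : S, s * t * s = s ∧ t * s * t = t

/-- A stationarily measurable space `(X, S, 𝒜)`: a measurable space on which an inverse monoid
acts (on the left) by measurable maps. -/
structure StatMeas : Type (max (u + 1) (v + 1)) where
  /-- the underlying set `X` -/
  carrier : Type u
  /-- the inverse monoid `S` of symmetries -/
  sym : Type v
  [measurableSpace : MeasurableSpace carrier]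
  [monoid : Monoid sym]
  [isInverseMonoid : IsInverseMonoid sym]
  [mulAction : MulAction sym carrier]
  [measurableConstSMul : MeasurableConstSMul sym carrier]

attribute [instance] StatMeas.measurableSpace StatMeas.monoid StatMeas.isInverseMonoid
  StatMeas.mulAction StatMeas.measurableConstSMul

namespace StatMeas

/-- A morphism `(X, S, 𝒜) ⟶ (Y, T, ℬ)`: a measurable map `f` for which there exists a homomorphism
`φ : T → S` with `f⁻¹ (t⁻¹ B) = (φ t)⁻¹ (f⁻¹ B)` for all `t ∈ T`, `B ∈ ℬ`. -/
@[ext]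
structure Hom (X Y : StatMeas.{u, v}) : Type u where
  /-- the underlying map -/
  toFun : X.carrier → Y.carrier
  measurable_toFun : Measurable toFun
  exists_pullback : ∃ φ : Y.sym →* X.sym, ∀ (t : Y.sym) (B : Set Y.carrier), MeasurableSet B →
    toFun ⁻¹' ((fun y => t • y) ⁻¹' B) = (fun x => φ t • x) ⁻¹' (toFun ⁻¹' B)

instance : Category StatMeas.{u, v} where
  Hom := Hom
  id X := ⟨id, measurable_id, MonoidHom.id _, fun _ _ _ => rfl⟩
  comp {X Y Z} f g :=
    { toFun := g.toFun ∘ f.toFun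
      measurable_toFun := g.measurable_toFun.comp f.measurable_toFun
      exists_pullback := by
        obtain ⟨φ, hφ⟩ := f.exists_pullback
        obtain ⟨ψ, hψ⟩ := g.exists_pullback
        refine ⟨φ.comp ψ, fun t B hB => ?_⟩
        rw [Set.preimage_comp, hψ t B hB, hφ _ _ (g.measurable_toFun hB)]
        rfl }

/-- The `σ`-algebra `𝒜`, as a type: the measurable subsets of `X`. -/
abbrev MSet (X : StatMeas.{u, v}) : Type u := {A : Set X.carrier // MeasurableSet A}

variable {X Y Z : StatMeas.{u, v}}

/-- The preimage `s⁻¹ A` of a measurable set under a symmetry. -/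
def MSet.pre (s : X.sym) (A : MSet X) : MSet X :=
  ⟨(fun x => s • x) ⁻¹' A.1, measurable_const_smul s A.2⟩

/-- The preimage `f⁻¹ B` of a measurable set under a morphism. -/
def MSet.comap (f : X ⟶ Y) (B : MSet Y) : MSet X :=
  ⟨Hom.toFun f ⁻¹' B.1, Hom.measurable_toFun f B.2⟩

/-- The empty set, as an element of `𝒜`. -/
def MSet.emp : MSet X := ⟨∅, MeasurableSet.empty⟩

/-- The union of a sequence of members of `𝒜`. -/
def MSet.iUnion (A : ℕ → MSet X) : MSet X := ⟨⋃ n, (A n).1, MeasurableSet.iUnion fun n => (A n).2⟩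

/-- The disjunctive algebra `𝒜̄`: its objects are the formal countable coproducts `∐ i, P i` of
measurable sets. (Finite coproducts are padded by empty sets. When two such expressions denote the
same coproduct is recorded by `DisjAlg.Same` below.) -/
abbrev DisjAlg (X : StatMeas.{u, v}) : Type u := ℕ → MSet X

namespace DisjAlg

/-- `A` is the disjoint union of the measurable sets `C n`. -/
def IsPartition (A : MSet X) (C : ℕ → MSet X) : Prop :=
  Pairwise (fun m n => Disjoint (C m).1 (C n).1) ∧ A.1 = ⋃ n, (C n).1

/-- `∐ i, P i` and `∐ k, Q k` are the same coproduct, up to measurable partitions of the summands: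
there is a common refinement `C i k`, the `i`-th row of which is a partition of `P i` and the `k`-th
column of which is a partition of `Q k`. -/
def Same (P Q : DisjAlg X) : Prop :=
  ∃ C : ℕ → ℕ → MSet X, (∀ i, IsPartition (P i) (C i)) ∧ ∀ k, IsPartition (Q k) fun i => C i k

/-- A measurable set, as a coproduct with one summand. -/
def single (A : MSet X) : DisjAlg X := fun i => if i = 0 then A else MSet.emp

/-- The coproduct `P ∐ Q` of two objects of `𝒜̄`. -/
def coprod₂ (P Q : DisjAlg X) : DisjAlg X := fun n =>
  Sum.elim P Q (Equiv.natSumNatEquivNat.symm n)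

/-- The coproduct `∐ j, P j` of a sequence of objects of `𝒜̄`. -/
def coprod (P : ℕ → DisjAlg X) : DisjAlg X := fun n => P n.unpair.1 n.unpair.2

/-- The action of `S` on `𝒜̄`: `s⁻¹ (∐ i, P i) = ∐ i, s⁻¹ (P i)`. -/
def pre (s : X.sym) (P : DisjAlg X) : DisjAlg X := fun i => MSet.pre s (P i)

/-- The map `f̄⁻¹ (∐ i, P i) = ∐ i, f⁻¹ (P i)`. -/
def comap (f : X ⟶ Y) (P : DisjAlg Y) : DisjAlg X := fun i => MSet.comap f (P i)

/-- `(S, 𝒜̄)`-equidecomposability: `P = ∐ j, P' j` and `Q = ∐ j, Q' j` with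
`(s j)⁻¹ (P' j) = (t j)⁻¹ (Q' j)` for all `j`, all equalities being equalities of coproducts. -/
def Equidec (P Q : DisjAlg X) : Prop :=
  ∃ (P' Q' : ℕ → DisjAlg X) (s t : ℕ → X.sym),
    Same P (coprod P') ∧ Same Q (coprod Q') ∧ ∀ j, Same (pre (s j) (P' j)) (pre (t j) (Q' j))

/-! Equidecomposability is an equivalence relation that respects coproducts. We pass through the
description by pieces that lie in single summands. -/

section Flat

/-- The sets `A k` are pieces of the summands `P (a k)` and partition all of them. -/
def Pieces {K : Type} (P : DisjAlg X) (a : K → ℕ) (A : K → MSet X) : Prop :=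
  (∀ k x, x ∈ (A k).1 → x ∈ (P (a k)).1) ∧
    ∀ i x, x ∈ (P i).1 → ∃! k, a k = i ∧ x ∈ (A k).1

/-- Equidecomposability by pieces in `𝒜`. -/
def Flat (P Q : DisjAlg X) : Prop :=
  ∃ (K : Type) (_ : Countable K) (a b : K → ℕ) (A B : K → MSet X) (s t : K → X.sym),
    Pieces P a A ∧ Pieces Q b B ∧ ∀ k, MSet.pre (s k) (A k) = MSet.pre (t k) (B k)

theorem mem_pre {s : X.sym} {A : MSet X} {x : X.carrier} :
    x ∈ (MSet.pre s A).1 ↔ s • x ∈ A.1 := Iff.rfl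

theorem not_mem_emp {x : X.carrier} : x ∉ (MSet.emp : MSet X).1 := fun h => h

theorem idem_comm {S : Type*} [Monoid S] [IsInverseMonoid S] {e f : S}
    (he : e * e = e) (hf : f * f = f) : e * f = f * e := by
  have key : ∀ e f : S, e * e = e → f * f = f → (e * f) * (e * f) = e * f := by
    intro e f he hf
    obtain ⟨x, ⟨h1, h2⟩, -⟩ := IsInverseMonoid.existsUnique_weakInv (e * f)
    obtain ⟨y, -, hu⟩ := IsInverseMonoid.existsUnique_weakInv (e * f)
    have hx : x = y := hu x ⟨h1, h2⟩
    have h3 : f * x * e = y := by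
      apply hu
      constructor
      · calc e * f * (f * x * e) * (e * f) = e * (f * f) * x * (e * e) * f := by
              simp only [mul_assoc]
          _ = e * f * x * (e * f) := by rw [he, hf]; simp only [mul_assoc]
          _ = e * f := h1
      · calc f * x * e * (e * f) * (f * x * e) = f * (x * ((e * e) * (f * f)) * x) * e := by
              simp only [mul_assoc]
          _ = f * x * e := by rw [he, hf, h2]
    have h4 : x = f * x * e := hx.trans h3.symm
    have hxx : x * x = x := by
      calc x * x = (f * x * e) * (f * x * e) := by rw [← h4]
        _ = f * (x * (e * f) * x) * e := by simp only [mul_assoc]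
        _ = x := by rw [h2, ← h4]
    obtain ⟨z, -, hz⟩ := IsInverseMonoid.existsUnique_weakInv x
    have e1 : x = z := hz x ⟨by rw [hxx, hxx], by rw [hxx, hxx]⟩
    have e2 : e * f = z := hz (e * f) ⟨h2, h1⟩
    have e3 : e * f = x := e2.trans e1.symm
    rw [e3, hxx]
  have hef := key e f he hf
  have hfe := key f e hf he
  obtain ⟨z, -, hz⟩ := IsInverseMonoid.existsUnique_weakInv (e * f)
  have h1 : e * f = z := hz _ ⟨by rw [hef, hef], by rw [hef, hef]⟩
  have h2 : f * e = z := by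
    apply hz
    constructor
    · calc e * f * (f * e) * (e * f) = e * (f * f) * (e * e) * f := by simp only [mul_assoc]
        _ = e * f * (e * f) := by rw [he, hf]; simp only [mul_assoc]
        _ = e * f := hef
    · calc f * e * (e * f) * (f * e) = f * (e * e) * (f * f) * e := by simp only [mul_assoc]
        _ = f * e * (f * e) := by rw [he, hf]; simp only [mul_assoc]
        _ = f * e := hfe
  exact h1.trans h2.symm

theorem Flat.symm {P Q : DisjAlg X} : Flat P Q → Flat Q P := by
  rintro ⟨K, hK, a, b, A, B, s, t, hP, hQ, h⟩
  exact ⟨K, hK, b, a, B, A, t, s, hQ, hP, fun k => (h k).symm⟩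

/-- Two relations between pieces over a common middle piece `C` can be composed. -/
theorem compose_piece {A B A' B' : MSet X} {s t p q : X.sym}
    (h : MSet.pre s A = MSet.pre t B) (h' : MSet.pre p A' = MSet.pre q B')
    {s' q' : X.sym} (hs : s * s' * s = s) (hq : q * q' * q = q)
    (hs' : s' * s * s' = s') (hq' : q' * q * q' = q') :
    ∃ g g' : X.sym, ∀ x : X.carrier,
      (g • x ∈ A.1 ∧ (t * s') • g • x ∈ B.1 ∩ A'.1) ↔
        (g' • x ∈ B'.1 ∧ (p * q') • g' • x ∈ B.1 ∩ A'.1) := by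
  have hA : ∀ x : X.carrier, s • x ∈ A.1 ↔ t • x ∈ B.1 := fun x =>
    Set.ext_iff.1 (congrArg Subtype.val h) x
  have hB : ∀ x : X.carrier, p • x ∈ A'.1 ↔ q • x ∈ B'.1 := fun x =>
    Set.ext_iff.1 (congrArg Subtype.val h') x
  have hd : (s' * s) * (s' * s) = s' * s := by
    rw [← mul_assoc, hs']
  have hc : (q' * q) * (q' * q) = q' * q := by
    rw [← mul_assoc, hq']
  obtain ⟨τ, ⟨h1, h2⟩, -⟩ := IsInverseMonoid.existsUnique_weakInv (t * (s' * s))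
  obtain ⟨υ, ⟨h3, h4⟩, -⟩ := IsInverseMonoid.existsUnique_weakInv (p * (q' * q))
  set T := t * (s' * s) with hT
  set U := p * (q' * q) with hU
  have hcomm : (T * τ) * (U * υ) = (U * υ) * (T * τ) :=
    idem_comm (by rw [← mul_assoc, h1]) (by rw [← mul_assoc, h3])
  -- `d h` and `c h'` are the common substitutions
  refine ⟨s * (τ * (U * υ)), q * (υ * (T * τ)), fun x => ?_⟩
  set w := (τ * (U * υ)) • x with hw
  set w' := (υ * (T * τ)) • x with hw'
  have e1 : (s * (τ * (U * υ))) • x = s • (s' * s) • w := by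
    rw [mul_smul, ← hw, ← mul_smul s (s' * s), ← mul_assoc s, hs]
  have e2 : (q * (υ * (T * τ))) • x = q • (q' * q) • w' := by
    rw [mul_smul, ← hw', ← mul_smul q (q' * q), ← mul_assoc q, hq]
  have e3 : T • w = U • w' := by
    rw [hw, hw', ← mul_smul, ← mul_smul, ← mul_assoc, hcomm, mul_assoc]
  have f1 : (t * s') • s • (s' * s) • w = T • w := by
    rw [← mul_smul, ← mul_smul, hT]
    congr 1
    calc t * s' * s * (s' * s) = t * ((s' * s) * (s' * s)) := by simp only [mul_assoc]
      _ = _ := by rw [hd]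
  have f2 : (p * q') • q • (q' * q) • w' = U • w' := by
    rw [← mul_smul, ← mul_smul, hU]
    congr 1
    calc p * q' * q * (q' * q) = p * ((q' * q) * (q' * q)) := by simp only [mul_assoc]
      _ = _ := by rw [hc]
  have g1 : t • (s' * s) • w = T • w := by rw [← mul_smul]
  have g2 : p • (q' * q) • w' = U • w' := by rw [← mul_smul]
  rw [e1, e2, f1, f2, hA, ← hB, g1, g2, e3]
  simp only [Set.mem_inter_iff]
  tauto

/-- The part of a piece that is missed by the transport to the other side is null. -/
theorem leftover_null {A B : MSet X} {s t : X.sym} (h : MSet.pre s A = MSet.pre t B)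
    {s' : X.sym} (hs : s * s' * s = s) (x : X.carrier) :
    ¬ (s • x ∈ A.1 ∧ (t * s') • s • x ∉ B.1) := by
  have hA : ∀ x : X.carrier, s • x ∈ A.1 ↔ t • x ∈ B.1 := fun x =>
    Set.ext_iff.1 (congrArg Subtype.val h) x
  rintro ⟨h1, h2⟩
  apply h2
  have : (t * s') • s • x = t • (s' * s) • x := by
    simp only [← mul_smul, mul_assoc]
  rw [this, ← hA, ← mul_smul, ← mul_assoc, hs]
  exact h1

theorem Flat.trans {P Q R : DisjAlg X} : Flat P Q → Flat Q R → Flat P R := by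
  rintro ⟨K, hK, a, b, A, B, s, t, hP, hQ, h⟩ ⟨L, hL, c, d, C, D, p, q, hQ', hR, h'⟩
  have hs := fun k => (IsInverseMonoid.existsUnique_weakInv (s k)).exists
  choose s' hs using hs
  have hq := fun l => (IsInverseMonoid.existsUnique_weakInv (q l)).exists
  choose q' hq using hq
  have hg := fun (k : K) (l : L) =>
    compose_piece (h k) (h' l) (hs k).1 (hq l).1 (hs k).2 (hq l).2
  choose g g' hg using hg
  -- the pieces on both sides
  let A' : {kl : K × L // b kl.1 = c kl.2} ⊕ (K ⊕ L) → MSet X := fun m => match m with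
    | Sum.inl kl => ⟨(A kl.1.1).1 ∩ (fun x => (t kl.1.1 * s' kl.1.1) • x) ⁻¹'
        ((B kl.1.1).1 ∩ (C kl.1.2).1), (A kl.1.1).2.inter
          (measurable_const_smul _ ((B kl.1.1).2.inter (C kl.1.2).2))⟩
    | Sum.inr (Sum.inl k) => ⟨(A k).1 \ (fun x => (t k * s' k) • x) ⁻¹' (B k).1,
        (A k).2.diff (measurable_const_smul _ (B k).2)⟩
    | Sum.inr (Sum.inr _) => MSet.emp
  let D' : {kl : K × L // b kl.1 = c kl.2} ⊕ (K ⊕ L) → MSet X := fun m => match m with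
    | Sum.inl kl => ⟨(D kl.1.2).1 ∩ (fun x => (p kl.1.2 * q' kl.1.2) • x) ⁻¹'
        ((B kl.1.1).1 ∩ (C kl.1.2).1), (D kl.1.2).2.inter
          (measurable_const_smul _ ((B kl.1.1).2.inter (C kl.1.2).2))⟩
    | Sum.inr (Sum.inl _) => MSet.emp
    | Sum.inr (Sum.inr l) => ⟨(D l).1 \ (fun x => (p l * q' l) • x) ⁻¹' (C l).1,
        (D l).2.diff (measurable_const_smul _ (C l).2)⟩
  refine ⟨{kl : K × L // b kl.1 = c kl.2} ⊕ (K ⊕ L), inferInstance,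
    Sum.elim (fun kl => a kl.1.1) (Sum.elim a fun _ => 0),
    Sum.elim (fun kl => d kl.1.2) (Sum.elim (fun _ => 0) d), A', D',
    Sum.elim (fun kl => g kl.1.1 kl.1.2) (Sum.elim s q),
    Sum.elim (fun kl => g' kl.1.1 kl.1.2) (Sum.elim s q), ⟨?_, ?_⟩, ⟨?_, ?_⟩, ?_⟩
  · rintro (kl | k | l) x hx
    · exact hP.1 _ _ hx.1
    · exact hP.1 _ _ hx.1
    · exact absurd hx not_mem_emp
  · intro i x hx
    obtain ⟨k, ⟨hk, hxk⟩, hku⟩ := hP.2 i x hx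
    by_cases hB : (t k * s' k) • x ∈ (B k).1
    · obtain ⟨l, ⟨hl, hxl⟩, hlu⟩ := hQ'.2 _ _ (hQ.1 _ _ hB)
      refine ⟨Sum.inl ⟨(k, l), hl.symm⟩, ⟨hk, hxk, hB, hxl⟩, ?_⟩
      rintro (⟨⟨k₁, l₁⟩, hkl⟩ | k₁ | l₁) ⟨h1, h2⟩
      · obtain rfl := hku k₁ ⟨h1, h2.1⟩
        obtain rfl := hlu l₁ ⟨hkl.symm, h2.2.2⟩
        rfl
      · obtain rfl := hku k₁ ⟨h1, h2.1⟩
        exact absurd hB h2.2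
      · exact absurd h2 not_mem_emp
    · refine ⟨Sum.inr (Sum.inl k), ⟨hk, hxk, hB⟩, ?_⟩
      rintro (⟨⟨k₁, l₁⟩, hkl⟩ | k₁ | l₁) ⟨h1, h2⟩
      · obtain rfl := hku k₁ ⟨h1, h2.1⟩
        exact absurd h2.2.1 hB
      · obtain rfl := hku k₁ ⟨h1, h2.1⟩
        rfl
      · exact absurd h2 not_mem_emp
  · rintro (kl | k | l) x hx
    · exact hR.1 _ _ hx.1
    · exact absurd hx not_mem_emp
    · exact hR.1 _ _ hx.1
  · intro i x hx
    obtain ⟨l, ⟨hl, hxl⟩, hlu⟩ := hR.2 i x hx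
    by_cases hC : (p l * q' l) • x ∈ (C l).1
    · obtain ⟨k, ⟨hk, hxk⟩, hku⟩ := hQ.2 _ _ (hQ'.1 _ _ hC)
      refine ⟨Sum.inl ⟨(k, l), hk⟩, ⟨hl, hxl, hxk, hC⟩, ?_⟩
      rintro (⟨⟨k₁, l₁⟩, hkl⟩ | k₁ | l₁) ⟨h1, h2⟩
      · obtain rfl := hlu l₁ ⟨h1, h2.1⟩
        obtain rfl := hku k₁ ⟨hkl, h2.2.1⟩
        rfl
      · exact absurd h2 not_mem_emp
      · obtain rfl := hlu l₁ ⟨h1, h2.1⟩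
        exact absurd hC h2.2
    · refine ⟨Sum.inr (Sum.inr l), ⟨hl, hxl, hC⟩, ?_⟩
      rintro (⟨⟨k₁, l₁⟩, hkl⟩ | k₁ | l₁) ⟨h1, h2⟩
      · obtain rfl := hlu l₁ ⟨h1, h2.1⟩
        exact absurd h2.2.2 hC
      · exact absurd h2 not_mem_emp
      · obtain rfl := hlu l₁ ⟨h1, h2.1⟩
        rfl
  · rintro (⟨⟨k, l⟩, hkl⟩ | k | l)
    · exact Subtype.ext (Set.ext fun x => hg k l x)
    · refine Subtype.ext (Set.ext fun x => iff_of_false (fun hx => ?_) not_mem_emp)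
      exact leftover_null (h k) (hs k).1 x hx
    · refine Subtype.ext (Set.ext fun x => iff_of_false not_mem_emp (fun hx => ?_))
      exact leftover_null (h' l).symm (hq l).1 x hx

theorem Flat.of_same {P Q : DisjAlg X} : Same P Q → Flat P Q := by
  rintro ⟨C, hP, hQ⟩
  refine ⟨ℕ × ℕ, inferInstance, Prod.fst, Prod.snd, fun m => C m.1 m.2, fun m => C m.1 m.2,
    fun _ => 1, fun _ => 1, ⟨?_, ?_⟩, ⟨?_, ?_⟩, fun _ => rfl⟩
  · rintro ⟨i, k⟩ x hx
    rw [(hP i).2]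
    exact Set.mem_iUnion.2 ⟨k, hx⟩
  · intro i x hx
    rw [(hP i).2] at hx
    obtain ⟨k, hk⟩ := Set.mem_iUnion.1 hx
    refine ⟨(i, k), ⟨rfl, hk⟩, ?_⟩
    rintro ⟨i', k'⟩ ⟨rfl, h2⟩
    by_contra hne
    exact Set.disjoint_left.1 ((hP i').1 (fun he : k' = k => hne (by rw [he]))) h2 hk
  · rintro ⟨i, k⟩ x hx
    rw [(hQ k).2]
    exact Set.mem_iUnion.2 ⟨i, hx⟩
  · intro k x hx
    rw [(hQ k).2] at hx
    obtain ⟨i, hi⟩ := Set.mem_iUnion.1 hx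
    refine ⟨(i, k), ⟨rfl, hi⟩, ?_⟩
    rintro ⟨i', k'⟩ ⟨rfl, h2⟩
    by_contra hne
    exact Set.disjoint_left.1 ((hQ k').1 (fun he : i' = i => hne (by rw [he]))) h2 hi

/-- Matching summands that are equal; the unmatched summands are empty. -/
theorem Flat.of_match {P Q : DisjAlg X} {K : Type} [Countable K] (a b : K → ℕ)
    (ha : Function.Injective a) (hb : Function.Injective b) (h : ∀ k, P (a k) = Q (b k))
    (hP : ∀ i x, x ∈ (P i).1 → ∃ k, a k = i) (hQ : ∀ i x, x ∈ (Q i).1 → ∃ k, b k = i) :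
    Flat P Q := by
  refine ⟨K, inferInstance, a, b, fun k => P (a k), fun k => Q (b k), fun _ => 1, fun _ => 1,
    ⟨fun _ _ hx => hx, ?_⟩, ⟨fun _ _ hx => hx, ?_⟩, fun k => congrArg (MSet.pre 1) (h k)⟩
  · intro i x hx
    obtain ⟨k, rfl⟩ := hP i x hx
    exact ⟨k, ⟨rfl, hx⟩, fun k' hk' => ha hk'.1⟩
  · intro i x hx
    obtain ⟨k, rfl⟩ := hQ i x hx
    exact ⟨k, ⟨rfl, hx⟩, fun k' hk' => hb hk'.1⟩

theorem Flat.refl (P : DisjAlg X) : Flat P P :=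
  Flat.of_match id id Function.injective_id Function.injective_id (fun _ => rfl) (fun i _ _ => ⟨i, rfl⟩)
    (fun i _ _ => ⟨i, rfl⟩)

theorem Flat.pre (s : X.sym) (P : DisjAlg X) : Flat P (DisjAlg.pre s P) := by
  refine ⟨ℕ, inferInstance, id, id, P, DisjAlg.pre s P, fun _ => s, fun _ => 1,
    ⟨fun _ _ hx => hx, fun i x hx => ⟨i, ⟨rfl, hx⟩, fun _ h => h.1⟩⟩,
    ⟨fun _ _ hx => hx, fun i x hx => ⟨i, ⟨rfl, hx⟩, fun _ h => h.1⟩⟩, fun k => ?_⟩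
  refine Subtype.ext (Set.ext fun x => ?_)
  rw [mem_pre, mem_pre, one_smul]
  rfl

theorem Flat.coprod {P Q : ℕ → DisjAlg X} (h : ∀ j, Flat (P j) (Q j)) :
    Flat (DisjAlg.coprod P) (DisjAlg.coprod Q) := by
  choose K hK a b A B s t hP hQ h using h
  have aux : ∀ (P : ℕ → DisjAlg X) (a : ∀ j, K j → ℕ) (A : ∀ j, K j → MSet X),
      (∀ j, Pieces (P j) (a j) (A j)) →
      Pieces (DisjAlg.coprod P) (fun m : Σ j, K j => Nat.pair m.1 (a m.1 m.2))
        (fun m => A m.1 m.2) := by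
    intro P a A hP
    refine ⟨?_, ?_⟩
    · rintro ⟨j, k⟩ x hx
      simpa only [DisjAlg.coprod, Nat.unpair_pair] using (hP j).1 k x hx
    · intro i x hx
      obtain ⟨k, ⟨h1, h2⟩, h3⟩ := (hP _).2 _ x hx
      refine ⟨⟨i.unpair.1, k⟩, ⟨by simp only [h1, Nat.pair_unpair], h2⟩, ?_⟩
      rintro ⟨j, k'⟩ ⟨rfl, h5⟩
      simp only [Nat.unpair_pair] at h3 k
      generalize hn : (Nat.pair j (a j k')).unpair = n at *
      rw [Nat.unpair_pair] at hn
      subst hn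
      obtain rfl := h3 k' ⟨rfl, h5⟩
      rfl
  exact ⟨Σ j, K j, inferInstance, _, _, _, _, fun m => s m.1 m.2, fun m => t m.1 m.2,
    aux P a A hP, aux Q b B hQ, fun m => h m.1 m.2⟩

theorem Flat.coprod₂ {P Q P' Q' : DisjAlg X} (h : Flat P Q) (h' : Flat P' Q') :
    Flat (DisjAlg.coprod₂ P P') (DisjAlg.coprod₂ Q Q') := by
  obtain ⟨K, hK, a, b, A, B, s, t, hP, hQ, h⟩ := h
  obtain ⟨L, hL, c, d, C, D, p, q, hP', hQ', h'⟩ := h'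
  have aux : ∀ (P P' : DisjAlg X) (a : K → ℕ) (c : L → ℕ) (A : K → MSet X) (C : L → MSet X),
      Pieces P a A → Pieces P' c C →
      Pieces (DisjAlg.coprod₂ P P')
        (fun m : K ⊕ L => Equiv.natSumNatEquivNat (Sum.map a c m)) (Sum.elim A C) := by
    intro P P' a c A C hP hP'
    refine ⟨?_, ?_⟩
    · rintro (k | l) x hx
      · simpa only [DisjAlg.coprod₂, Equiv.symm_apply_apply, Sum.map_inl, Sum.elim_inl] using hP.1 k x hx
      · simpa only [DisjAlg.coprod₂, Equiv.symm_apply_apply, Sum.map_inr, Sum.elim_inr] using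
          hP'.1 l x hx
    · intro n x hx
      obtain ⟨(i | i), rfl⟩ := Equiv.natSumNatEquivNat.surjective n
      · simp only [DisjAlg.coprod₂, Equiv.symm_apply_apply] at hx
        obtain ⟨k, ⟨rfl, h2⟩, h3⟩ := hP.2 _ x hx
        refine ⟨Sum.inl k, ⟨rfl, h2⟩, ?_⟩
        rintro (k' | l') ⟨h4, h5⟩ <;> have h4 := Equiv.natSumNatEquivNat.injective h4
        · rw [h3 k' ⟨Sum.inl_injective h4, h5⟩]
        · exact absurd h4 (by simp)
      · simp only [DisjAlg.coprod₂, Equiv.symm_apply_apply] at hx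
        obtain ⟨k, ⟨rfl, h2⟩, h3⟩ := hP'.2 _ x hx
        refine ⟨Sum.inr k, ⟨rfl, h2⟩, ?_⟩
        rintro (k' | l') ⟨h4, h5⟩ <;> have h4 := Equiv.natSumNatEquivNat.injective h4
        · exact absurd h4 (by simp)
        · rw [h3 l' ⟨Sum.inr_injective h4, h5⟩]
  refine ⟨K ⊕ L, inferInstance, _, _, _, _, Sum.elim s p, Sum.elim t q,
    aux P P' a c A C hP hP', aux Q Q' b d B D hQ hQ', ?_⟩
  rintro (k | l)
  · exact h k
  · exact h' l

theorem Flat.comap (f : X ⟶ Y) {P Q : DisjAlg Y} :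
    Flat P Q → Flat (DisjAlg.comap f P) (DisjAlg.comap f Q) := by
  rintro ⟨K, hK, a, b, A, B, s, t, hP, hQ, h⟩
  obtain ⟨φ, hφ⟩ := Hom.exists_pullback f
  refine ⟨K, hK, a, b, fun k => MSet.comap f (A k), fun k => MSet.comap f (B k),
    fun k => φ (s k), fun k => φ (t k), ⟨fun k x hx => hP.1 k _ hx, fun i x hx => hP.2 i _ hx⟩,
    ⟨fun k x hx => hQ.1 k _ hx, fun i x hx => hQ.2 i _ hx⟩, fun k => Subtype.ext ?_⟩
  exact (hφ _ _ (A k).2).symm.trans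
    ((congrArg (Hom.toFun f ⁻¹' ·) (congrArg Subtype.val (h k))).trans (hφ _ _ (B k).2))

theorem Same.refl (P : DisjAlg X) : Same P P := by
  have aux : ∀ i, IsPartition (P i) (fun k => if i = k then P i else MSet.emp) := by
    intro i
    refine ⟨fun m n hmn => ?_, ?_⟩
    · refine Set.disjoint_left.2 fun x hx hx' => ?_
      beta_reduce at hx hx'
      by_cases h : i = m
      · rw [if_neg (fun h' => hmn (h.symm.trans h'))] at hx'
        exact hx'
      · rw [if_neg h] at hx
        exact hx
    · ext x
      rw [Set.mem_iUnion]
      refine ⟨fun hx => ⟨i, by beta_reduce; rwa [if_pos rfl]⟩, ?_⟩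
      rintro ⟨k, hk⟩
      beta_reduce at hk
      split_ifs at hk
      · exact hk
      · exact absurd hk not_mem_emp
  refine ⟨fun i k => if i = k then P i else MSet.emp, aux, fun k => ?_⟩
  convert aux k using 2 with i
  beta_reduce
  by_cases h : i = k
  · rw [if_pos h, if_pos h.symm, h]
  · rw [if_neg h, if_neg (fun h' => h h'.symm)]

theorem Pieces.extend {K : Type} {P : DisjAlg X} {a : K → ℕ} {A : K → MSet X}
    (h : Pieces P a A) {f : K → ℕ} (hf : Function.Injective f) :
    Pieces P (Function.extend f a fun _ => 0) (Function.extend f A fun _ => MSet.emp) := by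
  have aux : ∀ n x, x ∈ (Function.extend f A (fun _ => MSet.emp) n).1 → ∃ k, f k = n := by
    intro n x hx
    by_contra hn
    rw [Function.extend_apply' _ _ _ hn] at hx
    exact hx
  refine ⟨fun n x hx => ?_, fun i x hx => ?_⟩
  · obtain ⟨k, rfl⟩ := aux n x hx
    rw [hf.extend_apply] at hx ⊢
    exact h.1 k x hx
  · obtain ⟨k, ⟨h1, h2⟩, h3⟩ := h.2 i x hx
    refine ⟨f k, ?_, ?_⟩
    · beta_reduce
      rw [hf.extend_apply, hf.extend_apply]
      exact ⟨h1, h2⟩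
    · rintro n ⟨h4, h5⟩
      obtain ⟨k', rfl⟩ := aux n x h5
      rw [hf.extend_apply] at h4 h5
      rw [h3 k' ⟨h4, h5⟩]

theorem Pieces.same {P : DisjAlg X} {a : ℕ → ℕ} {A : ℕ → MSet X} (h : Pieces P a A) :
    Same P (DisjAlg.coprod fun j => single (A j)) := by
  have hmem : ∀ (i n : ℕ) (x : X.carrier), x ∈ (if n.unpair.2 = 0 ∧ a n.unpair.1 = i then A n.unpair.1
      else MSet.emp).1 ↔ (n.unpair.2 = 0 ∧ a n.unpair.1 = i) ∧ x ∈ (A n.unpair.1).1 := by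
    intro i n x
    split_ifs with hc
    · simp [hc]
    · simp only [hc, false_and, iff_false]
      exact not_mem_emp
  refine ⟨fun i n => if n.unpair.2 = 0 ∧ a n.unpair.1 = i then A n.unpair.1 else MSet.emp,
    fun i => ⟨fun m n hmn => ?_, ?_⟩, fun n => ⟨fun i j hij => ?_, ?_⟩⟩
  · refine Set.disjoint_left.2 fun x hx hx' => ?_
    beta_reduce at hx hx'
    rw [hmem] at hx hx'
    apply hmn
    have hxP := h.1 _ _ hx.2
    rw [hx.1.2] at hxP
    have h1 := (h.2 i x hxP).unique ⟨hx.1.2, hx.2⟩ ⟨hx'.1.2, hx'.2⟩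
    rw [← Nat.pair_unpair m, ← Nat.pair_unpair n, h1, hx.1.1, hx'.1.1]
  · ext x
    simp only [Set.mem_iUnion, hmem]
    constructor
    · intro hx
      obtain ⟨k, ⟨h1, h2⟩, -⟩ := h.2 i x hx
      exact ⟨Nat.pair k 0, by simpa using ⟨h1, h2⟩⟩
    · rintro ⟨n, ⟨-, rfl⟩, hx⟩
      exact h.1 _ _ hx
  · refine Set.disjoint_left.2 fun x hx hx' => ?_
    beta_reduce at hx hx'
    rw [hmem] at hx hx'
    exact hij (hx.1.2.symm.trans hx'.1.2)
  · ext x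
    simp only [Set.mem_iUnion, hmem, DisjAlg.coprod, single]
    by_cases hn : n.unpair.2 = 0
    · simp [hn]
    · simp only [hn, if_false, false_and, exists_false, iff_false]
      exact not_mem_emp

theorem equidec_iff_flat {P Q : DisjAlg X} : Equidec P Q ↔ Flat P Q := by
  constructor
  · rintro ⟨P', Q', s, t, hP, hQ, h⟩
    refine (Flat.of_same hP).trans (Flat.trans (Flat.coprod fun j => ?_) (Flat.of_same hQ).symm)
    exact (Flat.pre (s j) (P' j)).trans ((Flat.of_same (h j)).trans (Flat.pre (t j) (Q' j)).symm)
  · rintro ⟨K, hK, a, b, A, B, s, t, hP, hQ, h⟩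
    obtain ⟨f, hf⟩ := exists_injective_nat K
    refine ⟨fun j => single (Function.extend f A (fun _ => MSet.emp) j),
      fun j => single (Function.extend f B (fun _ => MSet.emp) j), Function.extend f s 1, Function.extend f t 1, (hP.extend hf).same,
      (hQ.extend hf).same, fun j => ?_⟩
    have : DisjAlg.pre (Function.extend f s 1 j)
          (single (Function.extend f A (fun _ => MSet.emp) j)) =
        DisjAlg.pre (Function.extend f t 1 j)
          (single (Function.extend f B (fun _ => MSet.emp) j)) := by
      funext i
      by_cases hj : ∃ k, f k = j
      · obtain ⟨k, rfl⟩ := hj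
        simp only [hf.extend_apply, DisjAlg.pre, single]
        by_cases hi : i = 0
        · simp only [hi, if_true, h k]
        · simp only [hi, if_false]
          rfl
      · simp only [Function.extend_apply' _ _ _ hj, DisjAlg.pre, Pi.one_apply]
    rw [this]
    exact Same.refl _

end Flat

theorem equidec_equivalence : Equivalence (Equidec (X := X)) where
  refl P := equidec_iff_flat.2 (Flat.refl P)
  symm h := equidec_iff_flat.2 (equidec_iff_flat.1 h).symm
  trans h h' := equidec_iff_flat.2 ((equidec_iff_flat.1 h).trans (equidec_iff_flat.1 h'))

/-- Equidecomposability, as a setoid on `𝒜̄`. -/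
def setoid (X : StatMeas.{u, v}) : Setoid (DisjAlg X) := ⟨Equidec, equidec_equivalence⟩

end DisjAlg

/-- The type monoid `𝒯(X, S, 𝒜)`: the quotient of `𝒜̄` by equidecomposability. -/
def TypeMonoid (X : StatMeas.{u, v}) : Type u := Quotient (DisjAlg.setoid X)

namespace TypeMonoid

/-- The type `[P]` of an object `P` of `𝒜̄`. -/
def mk (P : DisjAlg X) : TypeMonoid X := Quotient.mk (DisjAlg.setoid X) P

theorem mk_eq_mk {P Q : DisjAlg X} : mk P = mk Q ↔ DisjAlg.Equidec P Q :=
  ⟨fun h => Quotient.exact h, fun h => Quotient.sound h⟩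

theorem mk_eq_mk' {P Q : DisjAlg X} : mk P = mk Q ↔ DisjAlg.Flat P Q :=
  mk_eq_mk.trans DisjAlg.equidec_iff_flat

/-- `[P] + [Q] = [P ∐ Q]`. -/
instance : Add (TypeMonoid X) where
  add := Quotient.map₂ DisjAlg.coprod₂ fun _ _ h _ _ h' => DisjAlg.equidec_iff_flat.2
    (DisjAlg.Flat.coprod₂ (DisjAlg.equidec_iff_flat.1 h) (DisjAlg.equidec_iff_flat.1 h'))

/-- `0 = [∅]`. -/
instance : Zero (TypeMonoid X) where
  zero := mk (DisjAlg.single MSet.emp)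

theorem mk_add (P Q : DisjAlg X) : mk P + mk Q = mk (DisjAlg.coprod₂ P Q) := rfl

theorem not_mem_zero {i : ℕ} {x : X.carrier} : x ∉ (DisjAlg.single (MSet.emp : MSet X) i).1 := by
  unfold DisjAlg.single
  split_ifs <;> exact DisjAlg.not_mem_emp

instance : AddMonoid (TypeMonoid X) where
  add_assoc := by
    rintro ⟨P⟩ ⟨Q⟩ ⟨R⟩
    refine mk_eq_mk'.2 (DisjAlg.Flat.of_match (K := (ℕ ⊕ ℕ) ⊕ ℕ)
      (fun k => Equiv.natSumNatEquivNat (Sum.map Equiv.natSumNatEquivNat id k))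
      (fun k => Equiv.natSumNatEquivNat
        (Sum.map id Equiv.natSumNatEquivNat (Equiv.sumAssoc ℕ ℕ ℕ k))) ?_ ?_ ?_ ?_ ?_)
    · exact Equiv.natSumNatEquivNat.injective.comp
        (Sum.map_injective.2 ⟨Equiv.natSumNatEquivNat.injective, Function.injective_id⟩)
    · exact Equiv.natSumNatEquivNat.injective.comp
        ((Sum.map_injective.2 ⟨Function.injective_id, Equiv.natSumNatEquivNat.injective⟩).comp
          (Equiv.sumAssoc ℕ ℕ ℕ).injective)
    · rintro ((k | k) | k) <;> simp [DisjAlg.coprod₂]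
    · intro i _ _
      exact (Equiv.natSumNatEquivNat.surjective.comp
        (Sum.map_surjective.2 ⟨Equiv.natSumNatEquivNat.surjective, Function.surjective_id⟩)) i
    · intro i _ _
      exact (Equiv.natSumNatEquivNat.surjective.comp
        ((Sum.map_surjective.2 ⟨Function.surjective_id, Equiv.natSumNatEquivNat.surjective⟩).comp
          (Equiv.sumAssoc ℕ ℕ ℕ).surjective)) i
  zero_add := by
    rintro ⟨P⟩
    refine mk_eq_mk'.2 (DisjAlg.Flat.of_match (fun k => Equiv.natSumNatEquivNat (Sum.inr k)) id
      (Equiv.natSumNatEquivNat.injective.comp Sum.inr_injective) Function.injective_id ?_ ?_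
      (fun i _ _ => ⟨i, rfl⟩))
    · intro k
      simp [DisjAlg.coprod₂]
    · intro n x hx
      obtain ⟨(i | i), rfl⟩ := Equiv.natSumNatEquivNat.surjective n
      · simp only [DisjAlg.coprod₂, Equiv.symm_apply_apply] at hx
        exact absurd hx not_mem_zero
      · exact ⟨i, rfl⟩
  add_zero := by
    rintro ⟨P⟩
    refine mk_eq_mk'.2 (DisjAlg.Flat.of_match (fun k => Equiv.natSumNatEquivNat (Sum.inl k)) id
      (Equiv.natSumNatEquivNat.injective.comp Sum.inl_injective) Function.injective_id ?_ ?_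
      (fun i _ _ => ⟨i, rfl⟩))
    · intro k
      simp [DisjAlg.coprod₂]
    · intro n x hx
      obtain ⟨(i | i), rfl⟩ := Equiv.natSumNatEquivNat.surjective n
      · exact ⟨i, rfl⟩
      · simp only [DisjAlg.coprod₂, Equiv.symm_apply_apply] at hx
        exact absurd hx not_mem_zero
  nsmul := nsmulRec

/-- The sum of a sequence of types: `∑ j, [P j] = [∐ j, P j]`. It does not depend on the chosen
representatives, see `mk_sum`. -/
noncomputable def sum (α : ℕ → TypeMonoid X) : TypeMonoid X :=
  mk (DisjAlg.coprod fun j => Quotient.out (α j))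

theorem mk_sum (P : ℕ → DisjAlg X) : sum (fun j => mk (P j)) = mk (DisjAlg.coprod P) :=
  mk_eq_mk'.2 (DisjAlg.Flat.coprod fun j => mk_eq_mk'.1 (Quotient.out_eq (mk (P j))))

/-- The canonical preorder of a monoid: `α ≼ β` iff `α + γ = β` for some `γ`. -/
def Le (α β : TypeMonoid X) : Prop := ∃ γ, α + γ = β

/-- The map `𝒯 f : 𝒯(Y, T, ℬ) → 𝒯(X, S, 𝒜)`, `[B] ↦ [f̄⁻¹ B]`. -/
def map (f : X ⟶ Y) : TypeMonoid Y →+ TypeMonoid X where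
  toFun := Quotient.map (DisjAlg.comap f) fun _ _ h =>
    DisjAlg.equidec_iff_flat.2 (DisjAlg.Flat.comap f (DisjAlg.equidec_iff_flat.1 h))
  map_zero' := by
    refine congrArg mk (funext fun i => ?_)
    change MSet.comap f (DisjAlg.single MSet.emp i) = DisjAlg.single MSet.emp i
    unfold DisjAlg.single
    split_ifs <;> rfl
  map_add' := by
    rintro ⟨P⟩ ⟨Q⟩
    refine congrArg mk (funext fun n => ?_)
    obtain ⟨(i | i), rfl⟩ := Equiv.natSumNatEquivNat.surjective n <;>
      simp [DisjAlg.coprod₂, DisjAlg.comap]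

theorem map_mk (f : X ⟶ Y) (P : DisjAlg Y) : map f (mk P) = mk (DisjAlg.comap f P) := rfl

end TypeMonoid

/-- The Tarski type construction, a contravariant functor from `StatMeas` to monoids (written
additively). -/
def tarskiType : StatMeas.{u, v}ᵒᵖ ⥤ AddMonCat.{u} where
  obj X := AddMonCat.of (TypeMonoid X.unop)
  map f := AddMonCat.ofHom (TypeMonoid.map f.unop)
  map_id X := by
    ext ⟨P⟩
    rfl
  map_comp f g := by
    ext ⟨P⟩
    rfl

/-- Tarski measure `m : 𝒜 → 𝒯(X, S, 𝒜)`, `A ↦ [A]`. -/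
def tarskiMeasure (X : StatMeas.{u, v}) (A : MSet X) : TypeMonoid X :=
  TypeMonoid.mk (DisjAlg.single A)

end StatMeas

/-! The type monoid behaves like one of Tarski's cardinal algebras: besides countable sums it has a
refinement property (`refinement`) and a remainder property for infinite descents (`remainder`).
Both hold because a decomposition of a type can be realized inside any given representative
(`exists_isSplit`), so that abstract identities become summandwise set operations.

Antisymmetry is then Schröder–Bernstein: `β = α + β` forces countably many copies of `α` below `β`,
and anything with this property is absorbed by `β`. Iterated refinement of `α + γ = β + γ` shows
that `α` and `β` differ only by types absorbed by `γ` (`subtraction`), which gives cancellation of a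
`γ` lying below both sides.

To divide by `n`, first let the monoid of symmetries be countable. Exhaustion over all symmetries
and pairs of summands writes `α = δ + p`, `β = δ + q` with `p` and `q` orthogonal. Multiples of `p`
and `q` stay orthogonal, so `subtraction` applied to `n • α = n • β` leaves no common part, and `n •
δ` absorbs `n • p` and `n • q`. Hence `δ` absorbs `p` and `q`, and `α = δ = β`. In general, one
equidecomposition uses only countably many symmetries, and these lie in a countable inverse
submonoid. -/

namespace StatMeas

variable {X Y : StatMeas.{u, v}}

/-! ### Splittings in the disjunctive algebra -/

namespace DisjAlg

/-- Every summand of `P` is the disjoint union of the corresponding summands of `Q` and `R`. -/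
def IsSplit (P Q R : DisjAlg X) : Prop :=
  ∀ i x, (x ∈ (P i).1 ↔ x ∈ (Q i).1 ∨ x ∈ (R i).1) ∧ ¬ (x ∈ (Q i).1 ∧ x ∈ (R i).1)

/-- Each piece is matched with itself by the symmetry 1; `e` only lines the pieces up as summands.
-/
theorem Flat.of_pieces {K : Type} {P : DisjAlg X} {a : K → ℕ} {A : K → MSet X}
    (h : Pieces P a A) (e : K ≃ ℕ) : Flat P fun n => A (e.symm n) := by
  refine ⟨K, e.injective.countable, a, e, A, A, fun _ => 1, fun _ => 1, h,
    ⟨fun k x hx => by simpa using hx, fun i x hx => ⟨e.symm i, ⟨by simp, hx⟩, ?_⟩⟩, fun _ => rfl⟩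
  rintro k ⟨rfl, -⟩
  simp

theorem IsSplit.flat {P Q R : DisjAlg X} (h : IsSplit P Q R) : Flat P (coprod₂ Q R) := by
  refine Flat.of_pieces (K := ℕ ⊕ ℕ) (a := Sum.elim id id) (A := Sum.elim Q R) ⟨?_, ?_⟩
    Equiv.natSumNatEquivNat
  · rintro (k | k) x hx
    · exact (h k x).1.2 (Or.inl hx)
    · exact (h k x).1.2 (Or.inr hx)
  · intro i x hx
    rcases (h i x).1.1 hx with hx | hx
    · refine ⟨Sum.inl i, ⟨rfl, hx⟩, ?_⟩
      rintro (k | k) ⟨rfl, hk⟩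
      · rfl
      · exact absurd ⟨hx, hk⟩ (h _ x).2
    · refine ⟨Sum.inr i, ⟨rfl, hx⟩, ?_⟩
      rintro (k | k) ⟨rfl, hk⟩
      · exact absurd ⟨hk, hx⟩ (h _ x).2
      · rfl

theorem Flat.coprod_of_partition {P : DisjAlg X} {C : ℕ → DisjAlg X}
    (h : ∀ i, IsPartition (P i) fun j => C j i) : Flat P (DisjAlg.coprod C) := by
  refine Flat.of_pieces (K := ℕ × ℕ) (a := Prod.snd) (A := fun m => C m.1 m.2) ⟨?_, ?_⟩
    Nat.pairEquiv
  · rintro ⟨j, i⟩ x hx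
    rw [(h i).2]
    exact Set.mem_iUnion.2 ⟨j, hx⟩
  · intro i x hx
    rw [(h i).2] at hx
    obtain ⟨j, hj⟩ := Set.mem_iUnion.1 hx
    refine ⟨(j, i), ⟨rfl, hj⟩, ?_⟩
    rintro ⟨j', i'⟩ ⟨rfl, h2⟩
    by_contra hne
    exact Set.disjoint_left.1 ((h i').1 (fun he : j' = j => hne (by rw [he]))) h2 hj

/-! ### Pulling a splitting back along an equidecomposition -/

section Part

variable {K : Type} [Countable K]

/-- The union of the pieces with label in `W`, as an object of the disjunctive algebra. -/
def part (a : K → ℕ) (A : K → MSet X) (W : Set K) : DisjAlg X := fun i =>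
  ⟨⋃ k, {_x | k ∈ W ∧ a k = i} ∩ (A k).1,
    MeasurableSet.iUnion fun k => (MeasurableSet.const _).inter (A k).2⟩

theorem mem_part {a : K → ℕ} {A : K → MSet X} {W : Set K} {i : ℕ} {x : X.carrier} :
    x ∈ (part a A W i).1 ↔ ∃ k, (k ∈ W ∧ a k = i) ∧ x ∈ (A k).1 := by
  simp [part]

/-- Keeping only the pieces whose partners lie in the summands selected by `g` restricts an
equidecomposition to those summands. The index `n` carried along with a piece is determined by it,
since `g` is injective. -/
theorem Flat.part {P Q : DisjAlg X} {a b : K → ℕ} {A B : K → MSet X} {s t : K → X.sym}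
    (hP : Pieces P a A) (hQ : Pieces Q b B) (h : ∀ k, MSet.pre (s k) (A k) = MSet.pre (t k) (B k))
    {g : ℕ → ℕ} (hg : Function.Injective g) :
    Flat (DisjAlg.part a A {k | ∃ n, g n = b k}) fun n => Q (g n) := by
  refine ⟨{m : K × ℕ // g m.2 = b m.1}, inferInstance, fun m => a m.1.1, fun m => m.1.2,
    fun m => A m.1.1, fun m => B m.1.1, fun m => s m.1.1, fun m => t m.1.1,
    ⟨?_, ?_⟩, ⟨?_, ?_⟩, fun m => h m.1.1⟩
  · rintro ⟨⟨k, n⟩, hm⟩ x hx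
    exact mem_part.2 ⟨k, ⟨⟨n, hm⟩, rfl⟩, hx⟩
  · intro i x hx
    obtain ⟨k, ⟨⟨n, hn⟩, rfl⟩, hxk⟩ := mem_part.1 hx
    refine ⟨⟨(k, n), hn⟩, ⟨rfl, hxk⟩, ?_⟩
    rintro ⟨⟨k', n'⟩, hm⟩ ⟨h1, h2⟩
    obtain rfl := (hP.2 _ x (hP.1 _ _ hxk)).unique ⟨h1, h2⟩ ⟨rfl, hxk⟩
    obtain rfl := hg (hm.trans hn.symm)
    rfl
  · rintro ⟨⟨k, n⟩, hm⟩ x hx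
    have := hQ.1 _ _ hx
    rwa [← hm] at this
  · intro n x hx
    obtain ⟨k, ⟨h1, h2⟩, h3⟩ := hQ.2 _ x hx
    refine ⟨⟨(k, n), h1.symm⟩, ⟨rfl, h2⟩, ?_⟩
    rintro ⟨⟨k', n'⟩, hm⟩ ⟨rfl, h5⟩
    obtain rfl := h3 k' ⟨hm.symm, h5⟩
    rfl

end Part

/-- Each piece of `P` has its partner in a summand of `Q` or in one of `R`, never both; sorting the
pieces accordingly cuts `P` itself. -/
theorem Flat.exists_isSplit {P Q R : DisjAlg X} (h : Flat P (DisjAlg.coprod₂ Q R)) :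
    ∃ Q' R', IsSplit P Q' R' ∧ Flat Q' Q ∧ Flat R' R := by
  obtain ⟨K, hK, a, b, A, B, s, t, hP, hQ, h⟩ := h
  have h1 := Flat.part hP hQ h (Equiv.natSumNatEquivNat.injective.comp Sum.inl_injective)
  have h2 := Flat.part hP hQ h (Equiv.natSumNatEquivNat.injective.comp Sum.inr_injective)
  simp only [DisjAlg.coprod₂, Function.comp_apply, Equiv.symm_apply_apply, Sum.elim_inl,
    Sum.elim_inr] at h1 h2
  refine ⟨_, _, fun i x => ⟨⟨fun hx => ?_, ?_⟩, ?_⟩, h1, h2⟩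
  · obtain ⟨k, ⟨h3, h4⟩, -⟩ := hP.2 i x hx
    obtain ⟨(n | n), hn⟩ := Equiv.natSumNatEquivNat.surjective (b k)
    · exact Or.inl (mem_part.2 ⟨k, ⟨⟨n, hn⟩, h3⟩, h4⟩)
    · exact Or.inr (mem_part.2 ⟨k, ⟨⟨n, hn⟩, h3⟩, h4⟩)
  · rintro (hx | hx) <;>
    · obtain ⟨k, ⟨-, rfl⟩, h4⟩ := mem_part.1 hx
      exact hP.1 _ _ h4
  · rintro ⟨hx, hx'⟩
    obtain ⟨k, ⟨⟨n, hn⟩, hi⟩, h4⟩ := mem_part.1 hx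
    obtain ⟨k', ⟨⟨n', hn'⟩, hi'⟩, h4'⟩ := mem_part.1 hx'
    obtain rfl := (hP.2 i x (hi ▸ hP.1 _ _ h4)).unique ⟨hi, h4⟩ ⟨hi', h4'⟩
    exact absurd (Equiv.natSumNatEquivNat.injective (hn.trans hn'.symm)) (by simp)

/-- The summandwise intersection of a sequence. -/
def iInter (P : ℕ → DisjAlg X) : DisjAlg X := fun i =>
  ⟨⋂ n, (P n i).1, MeasurableSet.iInter fun n => (P n i).2⟩

theorem mem_iInter {P : ℕ → DisjAlg X} {i : ℕ} {x : X.carrier} :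
    x ∈ (iInter P i).1 ↔ ∀ n, x ∈ (P n i).1 := Set.mem_iInter

/-- The sequence decreases, and a point of `P m` either survives forever or is removed at exactly
one stage. The surviving part does not depend on `m`, which makes the remainder uniform. -/
theorem IsSplit.iInter {P B : ℕ → DisjAlg X} (h : ∀ n, IsSplit (P n) (B n) (P (n + 1))) (m : ℕ) :
    Flat (P m) (DisjAlg.coprod₂ (iInter P) (DisjAlg.coprod fun n => B (m + n))) := by
  have hanti : ∀ i x, Antitone fun n => x ∈ (P n i).1 := fun i x =>
    antitone_nat_of_succ_le fun n hx => (h n i x).1.2 (Or.inr hx)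
  have hB : ∀ i x n, x ∈ (B n i).1 ↔ x ∈ (P n i).1 ∧ x ∉ (P (n + 1) i).1 := fun i x n => by
    have := h n i x
    tauto
  let U : DisjAlg X := fun i => ⟨⋃ n, (B (m + n) i).1, MeasurableSet.iUnion fun n => (B _ i).2⟩
  have hU : ∀ i x, x ∈ (U i).1 ↔ ∃ n, x ∈ (B (m + n) i).1 := fun i x => Set.mem_iUnion
  have hs : IsSplit (P m) (DisjAlg.iInter P) U := by
    refine fun i x => ⟨⟨fun hx => ?_, ?_⟩, ?_⟩
    · rw [mem_iInter, hU]
      by_contra! hc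
      obtain ⟨⟨n, hn⟩, hc⟩ := hc
      have key : ∀ n, x ∈ (P (m + n) i).1 := by
        intro n
        induction n with
        | zero => exact hx
        | succ n ih =>
          by_contra hne
          exact hc n ((hB _ _ _).2 ⟨ih, hne⟩)
      exact hn (hanti i x (Nat.le_add_left n m) (key n))
    · rw [mem_iInter, hU]
      rintro (hx | ⟨n, hn⟩)
      · exact hx m
      · exact hanti i x (Nat.le_add_right m n) ((hB _ _ _).1 hn).1
    · rw [mem_iInter, hU]
      rintro ⟨hx, n, hn⟩
      exact ((hB _ _ _).1 hn).2 (hx _)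
  refine hs.flat.trans (Flat.coprod₂ (Flat.refl _) (Flat.coprod_of_partition fun i => ⟨?_, rfl⟩))
  refine (pairwise_disjoint_on fun n => (B (m + n) i).1).2 fun k l hkl =>
    Set.disjoint_left.2 fun x hx hx' => ((hB _ _ _).1 hx).2 ?_
  exact hanti i x (by omega) ((hB _ _ _).1 hx').1

/-! ### Exhaustion by common parts -/

/-- The coproduct whose only nonempty summand is `A`, in position `i`. -/
def atIndex (i : ℕ) (A : MSet X) : DisjAlg X := fun k =>
  ⟨{_x | k = i} ∩ A.1, (MeasurableSet.const _).inter A.2⟩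

theorem pieces_atIndex (i : ℕ) (A : MSet X) : Pieces (atIndex i A) (fun _ : Unit => i) fun _ => A :=
  ⟨fun _ _ hx => ⟨rfl, hx⟩, fun _ _ hx => ⟨(), ⟨hx.1.symm, hx.2⟩, fun _ _ => rfl⟩⟩

theorem Flat.atIndex (i j : ℕ) {A B : MSet X} {s t : X.sym} (h : MSet.pre s A = MSet.pre t B) :
    Flat (DisjAlg.atIndex i A) (DisjAlg.atIndex j B) :=
  ⟨Unit, inferInstance, _, _, _, _, fun _ => s, fun _ => t, pieces_atIndex i A, pieces_atIndex j B,
    fun _ => h⟩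

/-- The part of `A` that is moved into `B` by `s`. -/
def moved (s : X.sym) (A B : MSet X) : MSet X :=
  ⟨A.1 ∩ (MSet.pre s B).1, A.2.inter (MSet.pre s B).2⟩

theorem mem_moved {s : X.sym} {A B : MSet X} {x : X.carrier} :
    x ∈ (moved s A B).1 ↔ x ∈ A.1 ∧ s • x ∈ B.1 := Iff.rfl

/-- Symmetries need not be invertible, so the part of `A` sent into `B` by `s` is not compared with
its image but with the part of `B` sent into `A` by the weak inverse. Both have the same preimage
along suitable symmetries because `s' * s * s' = s'`. -/
theorem pre_moved {s s' : X.sym} (h : s' * s * s' = s') (A B : MSet X) :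
    MSet.pre s' (moved s A B) = MSet.pre (s * s') (moved s' B A) := by
  refine Subtype.ext (Set.ext fun x => ?_)
  rw [mem_pre, mem_pre, mem_moved, mem_moved, smul_smul, smul_smul, ← mul_assoc, h, and_comm]

/-- Summandwise difference. -/
def sdiff (P Q : DisjAlg X) : DisjAlg X := fun i => ⟨(P i).1 \ (Q i).1, (P i).2.diff (Q i).2⟩

theorem isSplit_sdiff {P Q : DisjAlg X} (h : ∀ i x, x ∈ (Q i).1 → x ∈ (P i).1) :
    IsSplit P Q (sdiff P Q) := by
  intro i x
  have := h i x
  change (_ ↔ _ ∨ (_ ∧ _)) ∧ ¬ (_ ∧ (_ ∧ _))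
  tauto

/-- If no symmetry moves a point of `P` into `Q`, equidecomposable parts of `P` and `Q` are
null. -/
theorem Flat.null_of_not_moved {P Q R R' : DisjAlg X}
    (h : ∀ i j (s : X.sym) x, x ∈ (P i).1 → s • x ∉ (Q j).1)
    (hR : ∀ i x, x ∈ (R i).1 → x ∈ (P i).1) (hR' : ∀ i x, x ∈ (R' i).1 → x ∈ (Q i).1)
    (hRR' : Flat R R') : Flat R (single MSet.emp) := by
  obtain ⟨K, hK, a, b, A, B, s, t, hA, hB, hst⟩ := hRR'
  refine ⟨K, hK, a, b, A, fun _ => MSet.emp, s, s, hA, ⟨fun _ _ hx => absurd hx not_mem_emp,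
    fun i x hx => absurd hx TypeMonoid.not_mem_zero⟩, fun k => Subtype.ext (Set.ext fun x => ?_)⟩
  refine iff_of_false (fun hx => ?_) not_mem_emp
  obtain ⟨s', hs', -⟩ := (IsInverseMonoid.existsUnique_weakInv (s k)).exists
  -- Otherwise `t k * s'` would carry a point of `P` into `Q`; thus every piece has empty preimage
  -- and is matched with the empty set.
  refine leftover_null (hst k) hs' x ⟨hx, fun hx' => ?_⟩
  exact h _ _ _ _ (hR _ _ (hA.1 _ _ hx)) (hR' _ _ (hB.1 _ _ hx'))

/-- Over a countable monoid of symmetries, a maximal common part can be split off from two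
objects of the disjunctive algebra. -/
theorem exists_max_common_part [Countable X.sym] (P Q : DisjAlg X) :
    ∃ (A B : ℕ → DisjAlg X) (P' Q' : DisjAlg X), (∀ n, Flat (A n) (B n)) ∧
      Flat P (DisjAlg.coprod₂ P' (DisjAlg.coprod A)) ∧
      Flat Q (DisjAlg.coprod₂ Q' (DisjAlg.coprod B)) ∧
      ∀ i j (s : X.sym) x, x ∈ (P' i).1 → s • x ∉ (Q' j).1 := by
  obtain ⟨e, he⟩ := exists_surjective_nat (ℕ × ℕ × X.sym)
  have hinv := fun s : X.sym => (IsInverseMonoid.existsUnique_weakInv s).exists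
  choose inv hinv using hinv
  -- At the triple `(i, j, s)`, remove from the `i`-th summand what `s` sends into the `j`-th
  -- summand of the other object, and from the latter what the weak inverse of `s` sends back.
  let step : DisjAlg X × DisjAlg X → ℕ × ℕ × X.sym → DisjAlg X × DisjAlg X := fun PQ m =>
    (atIndex m.1 (moved m.2.2 (PQ.1 m.1) (PQ.2 m.2.1)),
      atIndex m.2.1 (moved (inv m.2.2) (PQ.2 m.2.1) (PQ.1 m.1)))
  let seq : ℕ → DisjAlg X × DisjAlg X := fun n => Nat.rec (P, Q)
    (fun n PQ => (sdiff PQ.1 (step PQ (e n)).1, sdiff PQ.2 (step PQ (e n)).2)) n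
  have h1 : ∀ n, IsSplit (seq n).1 (step (seq n) (e n)).1 (seq (n + 1)).1 := fun n =>
    isSplit_sdiff fun i x hx => by
      obtain ⟨rfl, hx⟩ := hx
      exact hx.1
  have h2 : ∀ n, IsSplit (seq n).2 (step (seq n) (e n)).2 (seq (n + 1)).2 := fun n =>
    isSplit_sdiff fun i x hx => by
      obtain ⟨rfl, hx⟩ := hx
      exact hx.1
  have f1 := IsSplit.iInter h1 0
  have f2 := IsSplit.iInter h2 0
  simp only [zero_add] at f1 f2
  refine ⟨_, _, _, _, fun n => ?_, f1, f2, fun i j s x hx hx' => ?_⟩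
  · exact Flat.atIndex _ _ (pre_moved (hinv _).2 _ _)
  · obtain ⟨n, hn⟩ := he (i, j, s)
    rw [mem_iInter] at hx hx'
    -- A surviving point that `s` sends to a surviving point would have been removed when `(i, j,
    -- s)` was treated.
    refine (h1 n i x).2 ⟨?_, hx (n + 1)⟩
    change x ∈ (atIndex (e n).1 _ i).1
    rw [hn]
    exact ⟨rfl, hx n, hx' n⟩

end DisjAlg

/-! ### Countable sums, refinement and remainder -/

namespace TypeMonoid

theorem mk_surjective : Function.Surjective (mk (X := X)) := Quotient.exists_rep

theorem exists_rep_seq (α : ℕ → TypeMonoid X) : ∃ P : ℕ → DisjAlg X, (fun j => mk (P j)) = α :=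
  ⟨fun j => Quotient.out (α j), funext fun j => Quotient.out_eq (α j)⟩

theorem zero_eq_mk : (0 : TypeMonoid X) = mk fun _ => MSet.emp := by
  refine congrArg mk (funext fun i => ?_)
  unfold DisjAlg.single
  split_ifs <;> rfl

instance : AddCommMonoid (TypeMonoid X) where
  add_comm := by
    rintro ⟨P⟩ ⟨Q⟩
    refine mk_eq_mk'.2 (DisjAlg.Flat.of_match (K := ℕ ⊕ ℕ) Equiv.natSumNatEquivNat
      (fun k => Equiv.natSumNatEquivNat k.swap) Equiv.natSumNatEquivNat.injective
      (Equiv.natSumNatEquivNat.injective.comp Sum.swap_leftInverse.injective) ?_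
      (fun i _ _ => Equiv.natSumNatEquivNat.surjective i) fun i _ _ => ?_)
    · rintro (k | k) <;> simp [DisjAlg.coprod₂]
    · exact (Equiv.natSumNatEquivNat.surjective.comp Sum.swap_rightInverse.surjective) i

theorem sum_eq_add (α : ℕ → TypeMonoid X) : sum α = α 0 + sum fun n => α (n + 1) := by
  obtain ⟨P, rfl⟩ := exists_rep_seq α
  rw [mk_sum, mk_sum fun n => P (n + 1), mk_add]
  refine mk_eq_mk'.2 (DisjAlg.Flat.of_match (K := ℕ ⊕ ℕ × ℕ)
    (Sum.elim (fun i => Nat.pair 0 i) fun m => Nat.pair (m.1 + 1) m.2)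
    (fun k => Equiv.natSumNatEquivNat (Sum.map id Nat.pairEquiv k)) ?_
    (Equiv.natSumNatEquivNat.injective.comp
      (Sum.map_injective.2 ⟨Function.injective_id, Nat.pairEquiv.injective⟩)) ?_
    (fun n _ _ => ?_) fun n _ _ => ?_)
  · rintro (i | ⟨j, i⟩) (i' | ⟨j', i'⟩) h
    · simpa using h
    · simp at h
    · simp at h
    · simpa using h
  · rintro (i | ⟨j, i⟩) <;> simp [DisjAlg.coprod₂, DisjAlg.coprod]
  · rcases h : n.unpair with ⟨_ | j, i⟩
    · exact ⟨Sum.inl i, by rw [← Nat.pair_unpair n, h]; rfl⟩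
    · exact ⟨Sum.inr (j, i), by rw [← Nat.pair_unpair n, h]; rfl⟩
  · exact (Equiv.natSumNatEquivNat.surjective.comp
      (Sum.map_surjective.2 ⟨Function.surjective_id, Nat.pairEquiv.surjective⟩)) n

theorem sum_add (α β : ℕ → TypeMonoid X) : (sum fun n => α n + β n) = sum α + sum β := by
  obtain ⟨P, rfl⟩ := exists_rep_seq α
  obtain ⟨Q, rfl⟩ := exists_rep_seq β
  simp only [mk_add, mk_sum]
  refine mk_eq_mk'.2 (DisjAlg.Flat.of_match (K := ℕ × ℕ ⊕ ℕ × ℕ)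
    (Sum.elim (fun m => Nat.pair m.1 (Equiv.natSumNatEquivNat (Sum.inl m.2)))
      fun m => Nat.pair m.1 (Equiv.natSumNatEquivNat (Sum.inr m.2)))
    (fun k => Equiv.natSumNatEquivNat (Sum.map Nat.pairEquiv Nat.pairEquiv k)) ?_
    (Equiv.natSumNatEquivNat.injective.comp
      (Sum.map_injective.2 ⟨Nat.pairEquiv.injective, Nat.pairEquiv.injective⟩)) ?_
    (fun n _ _ => ?_) fun n _ _ => ?_)
  · rintro (⟨j, i⟩ | ⟨j, i⟩) (⟨j', i'⟩ | ⟨j', i'⟩) h <;>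
    simp only [Sum.elim_inl, Sum.elim_inr, Nat.pair_eq_pair, EmbeddingLike.apply_eq_iff_eq,
      Sum.inl.injEq, Sum.inr.injEq, reduceCtorEq, and_false] at h
    · rw [h.1, h.2]
    · rw [h.1, h.2]
  · rintro (⟨j, i⟩ | ⟨j, i⟩) <;> simp [DisjAlg.coprod₂, DisjAlg.coprod]
  · obtain ⟨(i | i), hi⟩ := Equiv.natSumNatEquivNat.surjective n.unpair.2
    · exact ⟨Sum.inl (n.unpair.1, i), by rw [Sum.elim_inl, hi, Nat.pair_unpair]⟩
    · exact ⟨Sum.inr (n.unpair.1, i), by rw [Sum.elim_inr, hi, Nat.pair_unpair]⟩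
  · exact (Equiv.natSumNatEquivNat.surjective.comp
      (Sum.map_surjective.2 ⟨Nat.pairEquiv.surjective, Nat.pairEquiv.surjective⟩)) n

theorem exists_isSplit {P : DisjAlg X} {β γ : TypeMonoid X} (h : mk P = β + γ) :
    ∃ Q R, DisjAlg.IsSplit P Q R ∧ mk Q = β ∧ mk R = γ := by
  obtain ⟨Q, rfl⟩ := mk_surjective β
  obtain ⟨R, rfl⟩ := mk_surjective γ
  obtain ⟨Q', R', hs, hQ, hR⟩ := DisjAlg.Flat.exists_isSplit (mk_eq_mk'.1 h)
  exact ⟨Q', R', hs, mk_eq_mk'.2 hQ, mk_eq_mk'.2 hR⟩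

theorem mk_eq_add_of_isSplit {P Q R : DisjAlg X} (h : DisjAlg.IsSplit P Q R) :
    mk P = mk Q + mk R := mk_eq_mk'.2 h.flat

/-- Representatives of `γ` and `δ` can be chosen to split `P ∐ Q` summandwise; restricting them to
the summands from `P` and from `Q` gives the four parts. -/
theorem refinement {α β γ δ : TypeMonoid X} (h : α + β = γ + δ) :
    ∃ a b c d, α = a + b ∧ β = c + d ∧ γ = a + c ∧ δ = b + d := by
  obtain ⟨P, rfl⟩ := mk_surjective α
  obtain ⟨Q, rfl⟩ := mk_surjective β
  obtain ⟨R, S, hs, rfl, rfl⟩ := exists_isSplit h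
  have hdec : ∀ R : DisjAlg X, R = DisjAlg.coprod₂
      (fun n => R (Equiv.natSumNatEquivNat (Sum.inl n)))
      (fun n => R (Equiv.natSumNatEquivNat (Sum.inr n))) := fun R => by
    funext n
    obtain ⟨(i | i), rfl⟩ := Equiv.natSumNatEquivNat.surjective n <;> simp [DisjAlg.coprod₂]
  refine ⟨_, _, _, _, mk_eq_add_of_isSplit fun i x => ?_, mk_eq_add_of_isSplit fun i x => ?_,
    congrArg mk (hdec R), congrArg mk (hdec S)⟩
  · simpa [DisjAlg.coprod₂] using hs (Equiv.natSumNatEquivNat (Sum.inl i)) x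
  · simpa [DisjAlg.coprod₂] using hs (Equiv.natSumNatEquivNat (Sum.inr i)) x

/-- The descent is realized by a nested sequence of objects, and `γ` is the type of its
intersection. -/
theorem remainder {α β : ℕ → TypeMonoid X} (h : ∀ n, α n = β n + α (n + 1)) :
    ∃ γ, ∀ n, α n = γ + sum fun k => β (n + k) := by
  have hsplit : ∀ n (P : DisjAlg X), mk P = α n →
      ∃ Q R, DisjAlg.IsSplit P Q R ∧ mk Q = β n ∧ mk R = α (n + 1) := fun n P hP =>
    exists_isSplit (hP.trans (h n))
  choose B R hs hB hR using hsplit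
  obtain ⟨P₀, hP₀⟩ := mk_surjective (α 0)
  let P : (n : ℕ) → {P : DisjAlg X // mk P = α n} := fun n =>
    Nat.rec ⟨P₀, hP₀⟩ (fun n P => ⟨R n P.1 P.2, hR n P.1 P.2⟩) n
  have hP : ∀ n, DisjAlg.IsSplit (P n).1 (B n (P n).1 (P n).2) (P (n + 1)).1 := fun n => hs n _ _
  refine ⟨mk (DisjAlg.iInter fun n => (P n).1), fun n => ?_⟩
  rw [← (P n).2, mk_eq_mk'.2 (DisjAlg.IsSplit.iInter hP n), ← mk_add, ← mk_sum]
  simp only [hB]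

/-! ### Absorption, antisymmetry and cancellation -/

theorem sum_const_add_self (α : TypeMonoid X) : α + (sum fun _ => α) = sum fun _ => α :=
  (sum_eq_add fun _ => α).symm

theorem le_add_right (α β : TypeMonoid X) : Le α (α + β) := ⟨β, rfl⟩

theorem le_add_left (α β : TypeMonoid X) : Le α (β + α) := ⟨β, add_comm _ _⟩

theorem Le.trans {α β γ : TypeMonoid X} : Le α β → Le β γ → Le α γ := by
  rintro ⟨δ, rfl⟩ ⟨ε, rfl⟩
  exact ⟨δ + ε, (add_assoc _ _ _).symm⟩

theorem add_eq_of_sum_le {α β : TypeMonoid X} (h : Le (sum fun _ => α) β) : α + β = β := by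
  obtain ⟨γ, rfl⟩ := h
  rw [← add_assoc, sum_const_add_self]

theorem sum_le_of_add_eq {α β : TypeMonoid X} (h : β = α + β) : Le (sum fun _ => α) β := by
  obtain ⟨γ, hγ⟩ := remainder (α := fun _ => β) (β := fun _ => α) fun _ => h
  exact ⟨γ, by rw [add_comm, ← hγ 0]⟩

theorem Le.antisymm {α β : TypeMonoid X} : Le α β → Le β α → α = β := by
  rintro ⟨γ, rfl⟩ ⟨δ, h⟩
  -- `α` absorbs `γ + δ`, hence lies above countably many copies of `γ` and absorbs `γ` alone.
  have h1 := sum_le_of_add_eq (α := γ + δ) (β := α) (by rw [add_comm, ← add_assoc, h])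
  rw [sum_add] at h1
  rw [add_comm]
  exact (add_eq_of_sum_le ((le_add_right _ _).trans h1)).symm

/-- Refining `a + c = b + c` yields `a = d + a'`, `b = d + b'` and `c = a' + c' = b' + c'`, an
equation of the same kind. Iterating, `δ` collects the parts `d`, while `α'` and `β'` are what
remains. Each stage takes a copy of `α'`, and likewise of `β'`, out of `γ`. -/
theorem subtraction {α β γ : TypeMonoid X} (h : α + γ = β + γ) :
    ∃ δ α' β', α = δ + α' ∧ β = δ + β' ∧ Le (sum fun _ => α') γ ∧ Le (sum fun _ => β') γ := by
  have hstep : ∀ p : {p : TypeMonoid X × TypeMonoid X × TypeMonoid X //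
      p.1 + p.2.2 = p.2.1 + p.2.2},
      ∃ (q : {p : TypeMonoid X × TypeMonoid X × TypeMonoid X //
        p.1 + p.2.2 = p.2.1 + p.2.2}) (d : TypeMonoid X),
        p.1.1 = d + q.1.1 ∧ p.1.2.1 = d + q.1.2.1 ∧ p.1.2.2 = q.1.1 + q.1.2.2 ∧
          p.1.2.2 = q.1.2.1 + q.1.2.2 := by
    rintro ⟨⟨a, b, c⟩, h⟩
    obtain ⟨d, a', b', c', h1, h2, h3, h4⟩ := refinement h
    exact ⟨⟨(a', b', c'), h4.symm.trans h2⟩, d, h1, h3, h4, h2⟩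
  choose next d h1 h2 h3 h4 using hstep
  let p : ℕ → {p : TypeMonoid X × TypeMonoid X × TypeMonoid X // p.1 + p.2.2 = p.2.1 + p.2.2} :=
    fun n => Nat.rec ⟨(α, β, γ), h⟩ (fun _ p => next p) n
  obtain ⟨α', hα⟩ := remainder (α := fun n => (p n).1.1) (β := fun n => d (p n)) fun n => h1 _
  obtain ⟨β', hβ⟩ := remainder (α := fun n => (p n).1.2.1) (β := fun n => d (p n)) fun n => h2 _
  obtain ⟨γ₁, hγ₁⟩ := remainder (α := fun n => (p n).1.2.2) (β := fun n => (p (n + 1)).1.1)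
    fun n => h3 _
  obtain ⟨γ₂, hγ₂⟩ := remainder (α := fun n => (p n).1.2.2) (β := fun n => (p (n + 1)).1.2.1)
    fun n => h4 _
  have e1 := hγ₁ 0
  have e2 := hγ₂ 0
  simp only [hα, sum_add] at e1
  simp only [hβ, sum_add] at e2
  refine ⟨sum fun k => d (p (0 + k)), α', β', (hα 0).trans (add_comm _ _),
    (hβ 0).trans (add_comm _ _), ?_, ?_⟩
  · exact ((le_add_right _ _).trans (le_add_left _ _)).trans ⟨0, by rw [add_zero]; exact e1.symm⟩
  · exact ((le_add_right _ _).trans (le_add_left _ _)).trans ⟨0, by rw [add_zero]; exact e2.symm⟩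

/-- The differences `α'` and `β'` are absorbed by `γ`, hence by `α` and `β`, so both equal `δ + α' +
β'`. -/
theorem add_right_cancel_of_le {α β γ : TypeMonoid X} (hα : Le γ α) (hβ : Le γ β)
    (h : α + γ = β + γ) : α = β := by
  obtain ⟨δ, α', β', h1, h2, h3, h4⟩ := subtraction h
  obtain ⟨x, hx⟩ := hα
  obtain ⟨y, hy⟩ := hβ
  have e1 : β' + α = α := by rw [← hx, ← add_assoc, add_eq_of_sum_le h4]
  have e2 : α' + β = β := by rw [← hy, ← add_assoc, add_eq_of_sum_le h3]
  rw [← e1, ← e2, h1, h2]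
  abel

theorem add_nsmul_cancel {α β : TypeMonoid X} (n : ℕ) (h : α + β + n • α = α + n • α) :
    α + β = α := by
  induction n with
  | zero => simpa using h
  | succ n ih =>
    -- One copy of `α` is cancelled; the leading `α` on each side guarantees that it lies below
    -- both.
    refine ih (add_right_cancel_of_le (γ := α) ?_ ?_ ?_)
    · rw [add_assoc]
      exact le_add_right _ _
    · exact le_add_right _ _
    · rw [add_assoc _ (n • α) α, ← succ_nsmul, h, add_assoc α, ← succ_nsmul]

/-! ### Orthogonality and division over a countable monoid -/

/-- Two types are orthogonal if they have no common nonzero part. -/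
def Orthogonal (α β : TypeMonoid X) : Prop := ∀ γ, Le γ α → Le γ β → γ = 0

theorem Orthogonal.symm {α β : TypeMonoid X} (h : Orthogonal α β) : Orthogonal β α :=
  fun γ h1 h2 => h γ h2 h1

theorem Orthogonal.nsmul_left {α β : TypeMonoid X} (h : Orthogonal α β) (n : ℕ) :
    Orthogonal (n • α) β := by
  induction n with
  | zero =>
    rintro γ ⟨δ, hδ⟩ -
    rw [zero_nsmul] at hδ
    exact Le.antisymm ⟨δ, hδ⟩ ⟨γ, zero_add γ⟩
  | succ n ih =>
    rintro γ ⟨δ, hδ⟩ hβ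
    rw [succ_nsmul] at hδ
    obtain ⟨a, b, c, d, rfl, -, h1, h2⟩ := refinement hδ
    rw [ih a ⟨c, h1.symm⟩ ((le_add_right _ _).trans hβ),
      h b ⟨d, h2.symm⟩ ((le_add_left _ _).trans hβ), add_zero]

theorem exists_add_orthogonal [Countable X.sym] (α β : TypeMonoid X) :
    ∃ δ p q, α = δ + p ∧ β = δ + q ∧ Orthogonal p q := by
  obtain ⟨P, rfl⟩ := mk_surjective α
  obtain ⟨Q, rfl⟩ := mk_surjective β
  obtain ⟨A, B, P', Q', hAB, hP, hQ, h⟩ := DisjAlg.exists_max_common_part P Q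
  refine ⟨mk (DisjAlg.coprod A), mk P', mk Q', ?_, ?_, ?_⟩
  · rw [add_comm]
    exact mk_eq_mk'.2 hP
  · rw [mk_eq_mk'.2 (DisjAlg.Flat.coprod hAB), add_comm]
    exact mk_eq_mk'.2 hQ
  · rintro γ ⟨p', hp⟩ ⟨q', hq⟩
    obtain ⟨R, S, hR, rfl, -⟩ := exists_isSplit hp.symm
    obtain ⟨R', S', hR', hRR', -⟩ := exists_isSplit hq.symm
    exact mk_eq_mk'.2 (DisjAlg.Flat.null_of_not_moved h
      (fun i x hx => (hR i x).1.2 (Or.inl hx)) (fun i x hx => (hR' i x).1.2 (Or.inl hx))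
      (mk_eq_mk'.1 hRR').symm)

theorem add_eq_self_of_sum_nsmul_le {δ p : TypeMonoid X} {n : ℕ}
    (h : Le (sum fun _ => (n + 1) • p) ((n + 1) • δ)) : δ + p = δ := by
  have h1 : δ + (n + 1) • p = δ := by
    refine add_nsmul_cancel n ?_
    have := add_eq_of_sum_le h
    rw [succ_nsmul' δ] at this
    rw [← this]
    abel
  refine Le.antisymm ?_ (le_add_right _ _)
  exact ⟨n • p, by rw [add_assoc, ← succ_nsmul', h1]⟩

theorem nsmul_cancel_of_countable [Countable X.sym] {n : ℕ} {α β : TypeMonoid X}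
    (h : (n + 1) • α = (n + 1) • β) : α = β := by
  obtain ⟨δ, p, q, rfl, rfl, hpq⟩ := exists_add_orthogonal α β
  rw [nsmul_add, nsmul_add, add_comm, add_comm _ ((n + 1) • q)] at h
  obtain ⟨d, p', q', hp, hq, hp', hq'⟩ := subtraction h
  -- `d` lies below both `(n + 1) • p` and `(n + 1) • q`.
  have hd : d = 0 := ((hpq.nsmul_left (n + 1)).symm.nsmul_left (n + 1)).symm d
    ⟨p', hp.symm⟩ ⟨q', hq.symm⟩
  rw [hd, zero_add] at hp hq
  rw [← hp] at hp'
  rw [← hq] at hq'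
  rw [add_eq_self_of_sum_nsmul_le hp', add_eq_self_of_sum_nsmul_le hq']

end TypeMonoid

/-! Restriction to a countable monoid of symmetries. -/

/-- Every element of the submonoid generated by a set closed under weak inverses has a weak inverse
in that submonoid. -/
theorem exists_weakInv_mem_closure {S : Type*} [Monoid S] [IsInverseMonoid S] {W : Set S}
    (hW : ∀ x ∈ W, ∃ y ∈ W, x * y * x = x ∧ y * x * y = y) {x : S}
    (hx : x ∈ Submonoid.closure W) :
    ∃ y ∈ Submonoid.closure W, x * y * x = x ∧ y * x * y = y := by
  induction hx using Submonoid.closure_induction with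
  | mem x hx =>
    obtain ⟨y, hy, h⟩ := hW x hx
    exact ⟨y, Submonoid.subset_closure hy, h⟩
  | one => exact ⟨1, one_mem _, by simp, by simp⟩
  | mul x₁ x₂ _ _ h₁ h₂ =>
    obtain ⟨y₁, hy₁, h1, h2⟩ := h₁
    obtain ⟨y₂, hy₂, h3, h4⟩ := h₂
    -- Commuting these idempotents makes `y₂ * y₁` a weak inverse of `x₁ * x₂`.
    have hc : (x₂ * y₂) * (y₁ * x₁) = (y₁ * x₁) * (x₂ * y₂) :=
      DisjAlg.idem_comm (by rw [← mul_assoc, h3]) (by rw [← mul_assoc, h2])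
    refine ⟨y₂ * y₁, mul_mem hy₂ hy₁, ?_, ?_⟩
    · calc x₁ * x₂ * (y₂ * y₁) * (x₁ * x₂) = x₁ * ((x₂ * y₂) * (y₁ * x₁)) * x₂ := by
            simp only [mul_assoc]
        _ = (x₁ * y₁ * x₁) * (x₂ * y₂ * x₂) := by rw [hc]; simp only [mul_assoc]
        _ = x₁ * x₂ := by rw [h1, h3]
    · calc y₂ * y₁ * (x₁ * x₂) * (y₂ * y₁) = y₂ * ((y₁ * x₁) * (x₂ * y₂)) * y₁ := by
            simp only [mul_assoc]
        _ = (y₂ * x₂ * y₂) * (y₁ * x₁ * y₁) := by rw [← hc]; simp only [mul_assoc]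
        _ = y₂ * y₁ := by rw [h2, h4]

/-- A countable set of symmetries lies in a countable inverse submonoid. -/
theorem exists_countable_inverse_submonoid {S : Type*} [Monoid S] [IsInverseMonoid S] {V : Set S}
    (hV : V.Countable) : ∃ N : Submonoid S, V ⊆ N ∧ Countable N ∧ IsInverseMonoid N := by
  have hinv := fun s : S => (IsInverseMonoid.existsUnique_weakInv s).exists
  choose inv hinv using hinv
  set W := V ∪ inv '' V with hW
  have hWc : W.Countable := hV.union (hV.image _)
  refine ⟨Submonoid.closure W, Set.subset_union_left.trans Submonoid.subset_closure, ?_, ⟨?_⟩⟩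
  · have := hWc.to_subtype
    -- The closure is an image of the free monoid on a countable set.
    rw [Submonoid.closure_eq_mrange]
    exact (Set.countable_range _).to_subtype
  · rintro ⟨x, hx⟩
    obtain ⟨y, hy, h1, h2⟩ := exists_weakInv_mem_closure (W := W) (by
      rintro x (hx | ⟨x, hx, rfl⟩)
      · exact ⟨inv x, Or.inr ⟨x, hx, rfl⟩, hinv x⟩
      · exact ⟨x, Or.inl hx, (hinv x).symm⟩) hx
    refine ⟨⟨y, hy⟩, ⟨Subtype.ext h1, Subtype.ext h2⟩, ?_⟩
    rintro ⟨z, hz⟩ ⟨h3, h4⟩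
    exact Subtype.ext ((IsInverseMonoid.existsUnique_weakInv x).unique
      ⟨congrArg Subtype.val h3, congrArg Subtype.val h4⟩ ⟨h1, h2⟩)

/-- The same measurable space with fewer symmetries. -/
abbrev restrict (X : StatMeas.{u, v}) (N : Submonoid X.sym) [IsInverseMonoid N] :
    StatMeas.{u, v} where
  carrier := X.carrier
  sym := N
  measurableConstSMul := ⟨fun s => measurable_const_smul (s : X.sym)⟩

/-- The identity map, as a morphism to the space with fewer symmetries. -/
def toRestrict (X : StatMeas.{u, v}) (N : Submonoid X.sym) [IsInverseMonoid N] :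
    X ⟶ X.restrict N where
  toFun := id
  measurable_toFun := measurable_id
  exists_pullback := ⟨N.subtype, fun _ _ _ => rfl⟩

namespace DisjAlg

/-- The `n`-fold coproduct of `P` with itself. -/
def copower (P : DisjAlg X) : ℕ → DisjAlg X
  | 0 => single MSet.emp
  | n + 1 => coprod₂ (copower P n) P

theorem Flat.exists_restrict {P Q : DisjAlg X} (h : Flat P Q) :
    ∃ (N : Submonoid X.sym) (_ : IsInverseMonoid N), Countable N ∧
      Flat (X := X.restrict N) P Q := by
  obtain ⟨K, hK, a, b, A, B, s, t, hP, hQ, h⟩ := h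
  obtain ⟨N, hV, hc, hN⟩ := exists_countable_inverse_submonoid
    ((Set.countable_range s).union (Set.countable_range t))
  exact ⟨N, hN, hc, K, hK, a, b, A, B, fun k => ⟨s k, hV (Or.inl ⟨k, rfl⟩)⟩,
    fun k => ⟨t k, hV (Or.inr ⟨k, rfl⟩)⟩, hP, hQ, h⟩

end DisjAlg

namespace TypeMonoid

theorem mk_copower (P : DisjAlg X) (n : ℕ) : mk (P.copower n) = n • mk P := by
  induction n with
  | zero => exact (zero_nsmul _).symm
  | succ n ih => rw [succ_nsmul, ← ih]; rfl

/-- Copowers do not involve the symmetries, so an equation between multiples can be read over either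
monoid. -/
theorem copower_restrict (N : Submonoid X.sym) [IsInverseMonoid N] (P : DisjAlg X) (n : ℕ) :
    DisjAlg.copower (X := X.restrict N) P n = P.copower n := by
  induction n with
  | zero => rfl
  | succ n ih => exact congrArg (fun Q => DisjAlg.coprod₂ Q P) ih

theorem nsmul_cancel {n : ℕ} (hn : 1 ≤ n) {α β : TypeMonoid X} (h : n • α = n • β) : α = β := by
  obtain ⟨n, rfl⟩ := Nat.exists_eq_add_of_le' hn
  obtain ⟨P, rfl⟩ := mk_surjective α
  obtain ⟨Q, rfl⟩ := mk_surjective β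
  rw [← mk_copower, ← mk_copower, mk_eq_mk'] at h
  obtain ⟨N, hN, hc, h⟩ := h.exists_restrict
  rw [← copower_restrict N P, ← copower_restrict N Q, ← mk_eq_mk', mk_copower, mk_copower] at h
  -- Equality over fewer symmetries is stronger: this map sends `[P]` over `N` to `[P]` over
  -- `X.sym`.
  exact congrArg (map (X.toRestrict N)) (nsmul_cancel_of_countable h)

theorem map_sum (f : X ⟶ Y) (α : ℕ → TypeMonoid Y) :
    map f (sum α) = sum fun i => map f (α i) := by
  obtain ⟨P, rfl⟩ := exists_rep_seq α
  simp only [map_mk]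
  rw [mk_sum, mk_sum]
  rfl

end TypeMonoid

/-! ### Tarski measure -/

theorem tarskiMeasure_iUnion (A : ℕ → MSet X)
    (hA : Pairwise fun i j => Disjoint (A i).1 (A j).1) :
    tarskiMeasure X (MSet.iUnion A) = TypeMonoid.sum fun i => tarskiMeasure X (A i) := by
  refine (TypeMonoid.mk_eq_mk'.2 (DisjAlg.Flat.coprod_of_partition fun i => ?_)).trans
    (TypeMonoid.mk_sum _).symm
  unfold DisjAlg.single
  split_ifs
  · exact ⟨hA, rfl⟩
  · exact ⟨fun _ _ _ => Set.disjoint_left.2 fun _ hx => absurd hx DisjAlg.not_mem_emp,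
      Set.iUnion_empty.symm⟩

theorem tarskiMeasure_pre (s : X.sym) (A : MSet X) :
    tarskiMeasure X A = tarskiMeasure X (MSet.pre s A) := by
  refine (TypeMonoid.mk_eq_mk'.2 (DisjAlg.Flat.pre s _)).trans
    (congrArg TypeMonoid.mk (funext fun i => ?_))
  unfold DisjAlg.pre DisjAlg.single
  split_ifs <;> rfl

theorem tarskiMeasure_comap (f : X ⟶ Y) (B : MSet Y) :
    tarskiMeasure X (MSet.comap f B) = TypeMonoid.map f (tarskiMeasure Y B) := by
  refine congrArg TypeMonoid.mk (funext fun i => ?_)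
  unfold DisjAlg.comap DisjAlg.single
  split_ifs <;> rfl

end StatMeas

theorem theorem1 :
    -- `𝒯` is a contravariant functor: `𝒯(X,S,𝒜)` is the quotient of `𝒜̄` by equidecomposability,
    -- with `[P] + [Q] = [P ∐ Q]`, `0 = [∅]` and `∑ j, [P j] = [∐ j, P j]`;
    -- `𝒯 f` is a monoid homomorphism with `𝒯 f [B] = [f̄⁻¹ B]`;
    -- identities and compositions are respected
    (∀ X : StatMeas.{u, v},
      StatMeas.tarskiType.obj (op X) = AddMonCat.of (StatMeas.TypeMonoid X) ∧
      Function.Surjective (StatMeas.TypeMonoid.mk (X := X)) ∧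
      (∀ P Q : StatMeas.DisjAlg X,
        StatMeas.TypeMonoid.mk P = StatMeas.TypeMonoid.mk Q ↔ StatMeas.DisjAlg.Equidec P Q) ∧
      (∀ P Q : StatMeas.DisjAlg X, StatMeas.TypeMonoid.mk P + StatMeas.TypeMonoid.mk Q =
        StatMeas.TypeMonoid.mk (StatMeas.DisjAlg.coprod₂ P Q)) ∧
      (0 : StatMeas.TypeMonoid X) = StatMeas.TypeMonoid.mk (fun _ => StatMeas.MSet.emp) ∧
      (∀ P : ℕ → StatMeas.DisjAlg X,
        StatMeas.TypeMonoid.sum (fun j => StatMeas.TypeMonoid.mk (P j)) =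
          StatMeas.TypeMonoid.mk (StatMeas.DisjAlg.coprod P))) ∧
    (∀ (X Y : StatMeas.{u, v}) (f : X ⟶ Y) (P : StatMeas.DisjAlg Y),
      (StatMeas.tarskiType.map f.op).hom (StatMeas.TypeMonoid.mk P) =
        StatMeas.TypeMonoid.mk (StatMeas.DisjAlg.comap f P)) ∧
    (∀ X : StatMeas.{u, v}, StatMeas.tarskiType.map (𝟙 X).op = 𝟙 (StatMeas.tarskiType.obj (op X))) ∧
    (∀ (X Y Z : StatMeas.{u, v}) (f : X ⟶ Y) (g : Y ⟶ Z),
      StatMeas.tarskiType.map (f ≫ g).op =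
        StatMeas.tarskiType.map g.op ≫ StatMeas.tarskiType.map f.op) ∧
    -- properties of the object map
    (∀ X : StatMeas.{u, v},
      (∀ α β : StatMeas.TypeMonoid X, α + β = β + α) ∧
      IsPartialOrder (StatMeas.TypeMonoid X) StatMeas.TypeMonoid.Le ∧
      (∀ (n : ℕ) (α β : StatMeas.TypeMonoid X), 1 ≤ n → n • α = n • β → α = β)) ∧
    -- properties of Tarski measure
    (∀ X : StatMeas.{u, v},
      StatMeas.tarskiMeasure X StatMeas.MSet.emp = 0 ∧
      (∀ A : ℕ → StatMeas.MSet X, Pairwise (fun i j => Disjoint (A i).1 (A j).1) →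
        StatMeas.tarskiMeasure X (StatMeas.MSet.iUnion A) =
          StatMeas.TypeMonoid.sum fun i => StatMeas.tarskiMeasure X (A i)) ∧
      (∀ (s : X.sym) (A : StatMeas.MSet X),
        StatMeas.tarskiMeasure X A = StatMeas.tarskiMeasure X (StatMeas.MSet.pre s A))) ∧
    -- properties of the morphism map
    (∀ (X Y : StatMeas.{u, v}) (f : X ⟶ Y),
      (∀ α : ℕ → StatMeas.TypeMonoid Y,
        (StatMeas.tarskiType.map f.op).hom (StatMeas.TypeMonoid.sum α) =
          StatMeas.TypeMonoid.sum fun i =>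
            ((StatMeas.tarskiType.map f.op).hom (α i) : StatMeas.TypeMonoid X)) ∧
      (∀ B : StatMeas.MSet Y,
        StatMeas.tarskiMeasure X (StatMeas.MSet.comap f B) =
          (StatMeas.tarskiType.map f.op).hom (StatMeas.tarskiMeasure Y B))) := by
  refine ⟨fun X => ⟨rfl, StatMeas.TypeMonoid.mk_surjective,
      fun _ _ => StatMeas.TypeMonoid.mk_eq_mk, StatMeas.TypeMonoid.mk_add,
      StatMeas.TypeMonoid.zero_eq_mk, StatMeas.TypeMonoid.mk_sum⟩,
    fun _ _ f P => StatMeas.TypeMonoid.map_mk f P, fun X => StatMeas.tarskiType.map_id (op X),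
    fun X Y Z f g => StatMeas.tarskiType.map_comp g.op f.op,
    fun X => ⟨add_comm, { refl := fun α => ⟨0, add_zero α⟩
                          trans := fun _ _ _ => StatMeas.TypeMonoid.Le.trans
                          antisymm := fun _ _ => StatMeas.TypeMonoid.Le.antisymm },
      fun _ _ _ hn => StatMeas.TypeMonoid.nsmul_cancel hn⟩,
    fun X => ⟨rfl, StatMeas.tarskiMeasure_iUnion, StatMeas.tarskiMeasure_pre⟩,
    fun X Y f => ⟨StatMeas.TypeMonoid.map_sum f, StatMeas.tarskiMeasure_comap f⟩⟩
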